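/- Write $[n]=\{1,\dots,n\}$ and let $n\ge 0$. **Forests.** A *non-ambiguous forest* is a finite set $A\subset\mathbb N\times\mathbb N$ (with $0\in\mathbb N$) such that (1) no point $p=(x,y)\in A$ has both a point $(x,y')\in A$ with $y'<y$ and a point $(x',y)\in A$ with $x'<x$; and (2) if $(x,y)\in A$, then every $x'<x$ is the first coordinate of some point of $A$, and every $y'<y$ is the second coordinate of some point of $A$. A point of $A$ with neither kind of predecessor in (1) is a *root*. Any other point $p$ has as *parent* the nearest such predecessor, and $p$ is a *left* child if the parent has the same first coordinate and a *right* child if it has the same second coordinate. The forest is *complete* if each point has $0$ or $2$ children. Points without children are *leaves*. **Pairs.** A pair $(\pi,\xi)$ of permutations of $[n]$ has *no common rise* if there is no $i$ with $1\le i<n$, $\pi(i)<\pi(i+1)$ and $\xi(i)<\xi(i+1)$. **Heaps.** Two paths $(a_1,a_2)$, $(b_1,b_2)$ are *crossing* unless $a_1<b_1$ and $a_2<b_2$, or $b_1<a_1$ and $b_2<a_2$. Let $\mathcal H_n$ be the set of pairs $(\sigma,\le)$, where $\sigma$ is a permutation of $[n]$ and $\le$ is a partial order on its set of paths $\{(i,\sigma(i))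 : i\in[n]\}$ such that any two crossing paths are comparable, and whenever one path covers another, the two are crossing. **Theorem.** For every $n\ge 0$ there are bijections $s$ from the set of complete non-ambiguous forests with $n$ leaves onto $\mathcal H_n$ and $t$ from the set of pairs $(\pi,\xi)$ of permutations of $[n]$ with no common rise onto $\mathcal H_n$ such that: * for every forest $A$, the paths of $s(A)$ are the points $(x+1,y+1)$ for $(x,y)$ a leaf of $A$. Moreover, for distinct leaves $u,v$ whose paths are crossing, $u<v$ in $s(A)$ if and only if one of the following holds: $u$ lies in a tree whose root has smaller first coordinate than the root of the tree of $v$; or some $w\in A$ that is a root or a left child has $u$ in its right subtree and $v$ in its left subtree; or some $w\in A$ that is a right child has $u$ in its left subtree and $v$ in its right subtree; * for every pair $(\pi,\xi)$, the paths of $t(\pi,\xi)$ are the $(\pi(i),\xi(i))$, $i\in[n]$, and if $i<j$ and the paths $(\pi(i),\xi(i))$, $(\pi(j),\xi(j))$ are crossing, then $(\pi(j),\xi(j))<(\pi(i),\xi(i))$ in $t(\pi,\xi)$. Consequently $t^{-1}\circ s$ is a bijection between the set of complete non-ambiguous forests with $n$ leaves and the set of pairs $(\pi,\xi)$ of permutations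 of $[n]$ with no common rise. In particular both sets are finite, and their cardinalities $\tau(n)$ and $\omega(n)$ satisfy $\tau(n)=\omega(n)$. -/

import Mathlib

/-! ### Complete non-ambiguous forests -/

/-- A non-ambiguous forest: a finite set `A` of points of `ℕ × ℕ` such that no point of `A` has
both a point of `A` below it in its column and a point of `A` to its left in its row (the points
having neither are the roots), and such that there is no empty column and no empty row before
a point of `A`. -/
structure IsNonAmbiguousForest (A : Finset (ℕ × ℕ)) : Prop where
  not_both : ∀ p ∈ A, ¬ ((∃ q ∈ A, q.1 = p.1 ∧ q.2 < p.2) ∧ (∃ s ∈ A, s.2 = p.2 ∧ s.1 < p.1))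
  no_empty_column : ∀ p ∈ A, ∀ x' < p.1, ∃ q ∈ A, q.1 = x'
  no_empty_row : ∀ p ∈ A, ∀ y' < p.2, ∃ q ∈ A, q.2 = y'

/-- `c` is the left child of `w`: they lie in the same column, and `w` is the nearest point of `A`
before `c` in this column. -/
def IsLeftChild (A : Finset (ℕ × ℕ)) (w c : ℕ × ℕ) : Prop :=
  w ∈ A ∧ c ∈ A ∧ w.1 = c.1 ∧ w.2 < c.2 ∧ ∀ r ∈ A, r.1 = c.1 → r.2 < c.2 → r.2 ≤ w.2

/-- `c` is the right child of `w`: they lie in the same row, and `w` is the nearest point of `A`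
before `c` in this row. -/
def IsRightChild (A : Finset (ℕ × ℕ)) (w c : ℕ × ℕ) : Prop :=
  w ∈ A ∧ c ∈ A ∧ w.2 = c.2 ∧ w.1 < c.1 ∧ ∀ r ∈ A, r.2 = c.2 → r.1 < c.1 → r.1 ≤ w.1

instance (A : Finset (ℕ × ℕ)) (w c : ℕ × ℕ) : Decidable (IsLeftChild A w c) := by
  unfold IsLeftChild; infer_instance

instance (A : Finset (ℕ × ℕ)) (w c : ℕ × ℕ) : Decidable (IsRightChild A w c) := by
  unfold IsRightChild; infer_instance

/-- `w` is the parent of `c` in the underlying binary forest of `A`. -/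
def IsParent (A : Finset (ℕ × ℕ)) (w c : ℕ × ℕ) : Prop :=
  IsLeftChild A w c ∨ IsRightChild A w c

instance (A : Finset (ℕ × ℕ)) (w c : ℕ × ℕ) : Decidable (IsParent A w c) := by
  unfold IsParent; infer_instance

/-- The children of `w` in the underlying binary forest of `A`. -/
def childrenIn (A : Finset (ℕ × ℕ)) (w : ℕ × ℕ) : Finset (ℕ × ℕ) :=
  A.filter fun c => IsParent A w c

/-- The leaves of the underlying binary forest of `A`. -/
def leavesOf (A : Finset (ℕ × ℕ)) : Finset (ℕ × ℕ) :=
  A.filter fun w => (childrenIn A w).card = 0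

/-- A complete non-ambiguous forest: every vertex has either `0` or `2` children. -/
structure IsCompleteNonAmbiguousForest (A : Finset (ℕ × ℕ)) : Prop
    extends IsNonAmbiguousForest A where
  complete : ∀ w ∈ A, (childrenIn A w).card = 0 ∨ (childrenIn A w).card = 2

/-- The set of complete non-ambiguous forests with `n` leaves. -/
def CompleteNonAmbiguousForest (n : ℕ) : Type :=
  {A : Finset (ℕ × ℕ) // IsCompleteNonAmbiguousForest A ∧ (leavesOf A).card = n}

/-! ### Pairs of permutations with no common rise -/

/-- The set of pairs `(π, ξ)` of permutations of `n` letters with no common rise. -/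
def NoCommonRisePair (n : ℕ) : Type :=
  {p : Equiv.Perm (Fin n) × Equiv.Perm (Fin n) //
    ∀ i j : Fin n, (j : ℕ) = (i : ℕ) + 1 → ¬ (p.1 i < p.1 j ∧ p.2 i < p.2 j)}

/-! ### Heaps of crossing paths of a permutation -/

/-- A heap `(P, ≤, ε)` with pieces in `B` and concurrency relation `R` on `B`. -/
structure IsHeap {B : Type*} (R : B → B → Prop) {P : Type*} (ord : PartialOrder P)
    (ε : P → B) : Prop where
  finite : Finite P
  comparable : ∀ x y : P, R (ε x) (ε y) → x ≤ y ∨ y ≤ x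
  related_of_covers : ∀ x y : P, x ⋖ y → R (ε x) (ε y)

/-- Two paths `(a₁, a₂)` and `(b₁, b₂)` are crossing unless one lies strictly to the left of the
other. -/
def Crossing (a b : ℕ × ℕ) : Prop :=
  ¬ (a.1 < b.1 ∧ a.2 < b.2) ∧ ¬ (b.1 < a.1 ∧ b.2 < a.2)

/-- The path `(i, σ i)` of the permutation `σ` that starts from `i`. -/
def pathOf {n : ℕ} (σ : Equiv.Perm (Fin n)) (i : Fin n) : ℕ × ℕ :=
  ((i : ℕ), (σ i : ℕ))

/-- A heap of crossing paths whose elements are exactly the `n` paths of a permutation `σ`. The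
element `(i, σ i)` is represented by its starting point `i`. -/
structure PathHeap (n : ℕ) where
  /-- the permutation -/
  perm : Equiv.Perm (Fin n)
  /-- the order of the heap, on the starting points of the paths -/
  order : PartialOrder (Fin n)
  isHeap : IsHeap Crossing order (pathOf perm)

/-- The path from `i` lies strictly below the path from `j` in the heap `H` (here `i` and `j` are
compared in the order of the heap, not in that of `Fin n`). -/
def PathHeap.Below {n : ℕ} (H : PathHeap n) (i j : Fin n) : Prop :=
  H.order.lt i j

/-! ### The two correspondences -/

/-- `u` is `w` or a descendant of `w` in the underlying binary forest of `A`. -/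
def IsDescendant (A : Finset (ℕ × ℕ)) (w u : ℕ × ℕ) : Prop :=
  Relation.ReflTransGen (IsParent A) w u

/-- `w` is a root of the underlying binary forest of `A`. -/
def IsRoot (A : Finset (ℕ × ℕ)) (w : ℕ × ℕ) : Prop :=
  w ∈ A ∧ ∀ p, ¬ IsParent A p w

/-- `u` lies in the left subtree and `v` lies in the right subtree of the vertex `w`. -/
def BranchesAt (A : Finset (ℕ × ℕ)) (w u v : ℕ × ℕ) : Prop :=
  (∃ c, IsLeftChild A w c ∧ IsDescendant A c u) ∧ (∃ d, IsRightChild A w d ∧ IsDescendant A d v)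

/-- The rule that orders two leaves `u`, `v` of the forest `A` when they are crossing as paths:
`u` is put below `v` if
* `u` belongs to an earlier tree than `v`, trees being ordered by the column of their root (which
  is the column of their leftmost leaf), or
* they separate at a vertex `w` that is a root or a left child, `u` lying in the right subtree and
  `v` in the left subtree of `w`, or
* they separate at a vertex `w` that is a right child, `u` lying in the left subtree and `v` in
  the right subtree of `w`. -/
def LeafBelow (A : Finset (ℕ × ℕ)) (u v : ℕ × ℕ) : Prop :=
  (∃ r r', IsRoot A r ∧ IsRoot A r' ∧ IsDescendant A r u ∧ IsDescendant A r' v ∧ r.1 < r'.1) ∨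
  (∃ w, (IsRoot A w ∨ ∃ p, IsLeftChild A p w) ∧ BranchesAt A w v u) ∨
  (∃ w, (∃ p, IsRightChild A p w) ∧ BranchesAt A w u v)

/-- The heap `H` corresponds to the forest `A`: its elements are the leaves of `A`, and crossing
leaves are ordered by the rule above. -/
def ForestToHeap {n : ℕ} (A : CompleteNonAmbiguousForest n) (H : PathHeap n) : Prop :=
  (∀ u : ℕ × ℕ, u ∈ leavesOf A.1 ↔ ∃ i, pathOf H.perm i = u) ∧
  ∀ i j : Fin n, Crossing (pathOf H.perm i) (pathOf H.perm j) →
    (H.Below i j ↔ LeafBelow A.1 (pathOf H.perm i) (pathOf H.perm j))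

/-- The heap `H` corresponds to the pair `(π, ξ)`: its elements are the paths `(π i, ξ i)`, and
of two crossing paths the one that comes later in the pair is below the other one. -/
def PairToHeap {n : ℕ} (p : NoCommonRisePair n) (H : PathHeap n) : Prop :=
  (∀ i, H.perm (p.1.1 i) = p.1.2 i) ∧
  ∀ i j : Fin n, i < j →
    Crossing (pathOf H.perm (p.1.1 i)) (pathOf H.perm (p.1.1 j)) →
      H.Below (p.1.1 j) (p.1.1 i)

/-! A heap on the paths of a permutation is the same thing as an acyclic orientation of the crossing
pairs: the order is generated by its crossing pairs, because covers are crossing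
(`PathHeap.ext_of_crossing`, `PathHeap.exists_of_rank`). A pair `(π, ξ)` orders its paths linearly
by position, and a forest orders its leaves linearly by the branching rule. Restricted to crossing
pairs, each of these linear orders gives exactly one heap. What remains is to show that each heap
comes from exactly one pair and from exactly one forest.

For pairs, a heap has a canonical linear extension `PathHeap.Precedes`: upper pieces come first, and
of two incomparable pieces, which never cross, the right one comes first. This is transitive because
a piece incomparable to both ends of an interval, and to what lies between them, has the whole
interval on one side (`PathHeap.Below.strictlyLeft`). A sequence of paths realising the heap has no
common rise exactly when it is sorted in this way (`PairToHeap.precedes`, `existsUnique_pair`).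

For forests, a complete non-ambiguous tree is a complete binary tree with points as leaf labels,
since each inner vertex takes its column from its leftmost leaf and its row from its rightmost leaf.
By induction its leaves form a pyramid, that is, a heap with a single maximal piece: the leaf of
smallest column if the root counts as a left child, the leaf of smallest row if it counts as a right
child (`PointTree.Valid.reach`). Let `e` be the leaf of smallest column and `f` the leaf of smallest
row. At a root or left child the leaves of the right subtree are exactly the pieces weakly below
`f`; at a right child those of the left subtree are exactly the pieces weakly below `e`. In a
forest, the first tree consists of the pieces weakly below the leaf of smallest column. So the heap
dictates every splitting, which gives uniqueness (`ForestValid.eq_of_leaves_eq`), and carrying out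
these splittings on an arbitrary heap builds a forest (`exists_forest_of_heap`). -/

/-! ### Heaps of paths -/

/-- The path from `i` lies strictly to the left of the path from `j`. -/
def StrictlyLeft {n : ℕ} (σ : Equiv.Perm (Fin n)) (i j : Fin n) : Prop :=
  i < j ∧ σ i < σ j

theorem crossing_pathOf {n : ℕ} (σ : Equiv.Perm (Fin n)) (i j : Fin n) :
    Crossing (pathOf σ i) (pathOf σ j) ↔ ¬ StrictlyLeft σ i j ∧ ¬ StrictlyLeft σ j i := by
  simp [Crossing, pathOf, StrictlyLeft]

theorem Crossing.symm {a b : ℕ × ℕ} (h : Crossing a b) : Crossing b a := ⟨h.2, h.1⟩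

theorem StrictlyLeft.trans {n : ℕ} {σ : Equiv.Perm (Fin n)} {i j k : Fin n}
    (h : StrictlyLeft σ i j) (h' : StrictlyLeft σ j k) : StrictlyLeft σ i k :=
  ⟨h.1.trans h'.1, h.2.trans h'.2⟩

theorem StrictlyLeft.irrefl {n : ℕ} {σ : Equiv.Perm (Fin n)} (i : Fin n) :
    ¬ StrictlyLeft σ i i := fun h => lt_irrefl _ h.1

/-- In a finite poset a strict inequality refines to a chain of covers, and covers are concurrent.
-/
theorem IsHeap.transGen_of_lt {B P : Type*} {R : B → B → Prop} {ord : PartialOrder P} {ε : P → B}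
    (h : IsHeap R ord ε) {x y : P} (hxy : x < y) :
    Relation.TransGen (fun a b => a < b ∧ R (ε a) (ε b)) x y := by
  classical
  have := h.finite
  have := Fintype.ofFinite P
  let : LocallyFiniteOrder P := Fintype.toLocallyFiniteOrder
  exact Relation.TransGen.mono (fun a b hab => ⟨hab.1, h.related_of_covers a b hab⟩)
    _ _ (transGen_covBy_of_lt hxy)

namespace PathHeap

variable {n : ℕ} (H : PathHeap n)

theorem below_irrefl (i : Fin n) : ¬ H.Below i i :=
  @lt_irrefl _ H.order.toPreorder i

variable {H}

theorem Below.trans {i j k : Fin n} (h : H.Below i j) (h' : H.Below j k) : H.Below i k :=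
  @lt_trans _ H.order.toPreorder i j k h h'

theorem Below.not_below {i j : Fin n} (h : H.Below i j) : ¬ H.Below j i :=
  fun h' => H.below_irrefl i (h.trans h')

theorem below_or_below {i j : Fin n} (hne : i ≠ j)
    (h : Crossing (pathOf H.perm i) (pathOf H.perm j)) : H.Below i j ∨ H.Below j i := by
  rcases H.isHeap.comparable i j h with h | h
  · exact Or.inl (@lt_of_le_of_ne _ H.order i j h hne)
  · exact Or.inr (@lt_of_le_of_ne _ H.order j i h hne.symm)

theorem Below.transGen {i j : Fin n} (h : H.Below i j) :
    Relation.TransGen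
      (fun a b => H.Below a b ∧ Crossing (pathOf H.perm a) (pathOf H.perm b)) i j :=
  H.isHeap.transGen_of_lt h

theorem Below.of_crossing {r : Fin n → Fin n → Prop} (tr : ∀ a b c, r a b → r b c → r a c)
    (hr : ∀ a b, H.Below a b → Crossing (pathOf H.perm a) (pathOf H.perm b) → r a b)
    {i j : Fin n} (h : H.Below i j) : r i j := by
  have : IsTrans (Fin n) r := ⟨tr⟩
  rw [← Relation.transGen_eq_self (r := r)]
  exact Relation.TransGen.mono (fun a b hab => hr a b hab.1 hab.2) _ _ h.transGen

/-- The first link of a chain of crossings from `i` to `j`. If `i` and `j` do not cross, this yields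
a piece strictly between them. -/
theorem Below.exists_crossing {i j : Fin n} (h : H.Below i j) :
    ∃ c, H.Below i c ∧ Crossing (pathOf H.perm i) (pathOf H.perm c) ∧ (c = j ∨ H.Below c j) := by
  have : IsTrans (Fin n) H.Below := ⟨fun _ _ _ => Below.trans⟩
  obtain ⟨c, hc, hcj⟩ := Relation.TransGen.head'_iff.1 h.transGen
  refine ⟨c, hc.1, hc.2, ?_⟩
  rcases Relation.reflTransGen_iff_eq_or_transGen.1 hcj with h | h
  · exact Or.inl h.symm
  · right
    rw [← Relation.transGen_eq_self (r := H.Below)]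
    exact Relation.TransGen.mono (fun _ _ hab => hab.1) _ _ h

/-- A heap is determined by its permutation and the order of its crossing pieces. -/
theorem ext_of_crossing {H H' : PathHeap n} (hp : H.perm = H'.perm)
    (h : ∀ i j, Crossing (pathOf H.perm i) (pathOf H.perm j) → (H.Below i j ↔ H'.Below i j)) :
    H = H' := by
  have key : ∀ i j, H.Below i j ↔ H'.Below i j := fun i j =>
    ⟨Below.of_crossing (r := H'.Below) (fun _ _ _ => Below.trans) fun a b hb hc => (h a b hc).1 hb,
      Below.of_crossing (r := H.Below) (fun _ _ _ => Below.trans)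
        fun a b hb hc => (h a b (by rwa [hp])).2 hb⟩
  rcases H with ⟨p, o, hh⟩
  rcases H' with ⟨p', o', hh'⟩
  simp only at hp
  subst hp
  have : o = o' := by
    ext i j
    have e1 := @le_iff_lt_or_eq _ o i j
    have e2 := @le_iff_lt_or_eq _ o' i j
    rw [e1, e2]
    exact or_congr (key i j) Iff.rfl
  subst this
  rfl

/-- An acyclic orientation of the crossing pairs of a permutation comes from a heap. -/
theorem exists_of_rank (σ : Equiv.Perm (Fin n)) (B : Fin n → Fin n → Prop) (ρ : Fin n → ℕ)
    (hB : ∀ i j, i ≠ j → Crossing (pathOf σ i) (pathOf σ j) → B i j ∨ B j i)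
    (hρ : ∀ i j, B i j → ρ i < ρ j) :
    ∃ H : PathHeap n, H.perm = σ ∧
      ∀ i j, Crossing (pathOf σ i) (pathOf σ j) → (H.Below i j ↔ B i j) := by
  let R : Fin n → Fin n → Prop := fun i j => B i j ∧ Crossing (pathOf σ i) (pathOf σ j)
  -- The rank increases along `R`, so the reflexive transitive closure of `R` is antisymmetric.
  have hrank : ∀ {i j}, Relation.ReflTransGen R i j → i = j ∨ ρ i < ρ j := by
    intro i j h
    induction h with
    | refl => exact Or.inl rfl
    | tail _ h2 ih =>
      have := hρ _ _ h2.1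
      rcases ih with rfl | ih
      · exact Or.inr this
      · exact Or.inr (ih.trans this)
  let o : PartialOrder (Fin n) :=
    { le := Relation.ReflTransGen R
      lt := fun i j => Relation.ReflTransGen R i j ∧ ¬ Relation.ReflTransGen R j i
      lt_iff_le_not_ge := fun _ _ => Iff.rfl
      le_refl := fun _ => Relation.ReflTransGen.refl
      le_trans := fun _ _ _ => Relation.ReflTransGen.trans
      le_antisymm := fun i j h h' => by
        rcases hrank h with h | h
        · exact h
        · rcases hrank h' with h' | h'
          · exact h'.symm
          · omega }
  have hlt : ∀ i j, R i j → o.lt i j := by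
    intro i j h
    refine @lt_of_le_of_ne _ o i j (Relation.ReflTransGen.single h) ?_
    rintro rfl
    exact absurd (hρ _ _ h.1) (lt_irrefl _)
  have heap : IsHeap Crossing o (pathOf σ) :=
    { finite := inferInstance
      comparable := by
        intro i j h
        by_cases hij : i = j
        · exact Or.inl (hij ▸ Relation.ReflTransGen.refl)
        · rcases hB i j hij h with h' | h'
          · exact Or.inl (Relation.ReflTransGen.single ⟨h', h⟩)
          · exact Or.inr (Relation.ReflTransGen.single ⟨h', h.symm⟩)
      related_of_covers := by
        intro i j h
        obtain ⟨h1, h2⟩ := h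
        have hle : Relation.ReflTransGen R i j := @le_of_lt _ o.toPreorder i j h1
        -- The first link `i → k` of a chain from `i` to a cover `j` cannot stop strictly below `j`,
        -- so it is the whole chain.
        rcases Relation.ReflTransGen.cases_head hle with rfl | ⟨k, hik, hkj⟩
        · exact absurd h1 (@lt_irrefl _ o.toPreorder i)
        · by_cases hk : k = j
          · exact hk ▸ hik.2
          · exact absurd (@lt_of_le_of_ne _ o k j hkj hk) (h2 (hlt _ _ hik)) }
  refine ⟨⟨σ, o, heap⟩, rfl, fun i j h => ⟨fun h' => ?_, fun h' => hlt _ _ ⟨h', h⟩⟩⟩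
  have hne : i ≠ j := by
    rintro rfl
    exact @lt_irrefl _ o.toPreorder i h'
  rcases hB i j hne h with hb | hb
  · exact hb
  · exact absurd (hlt _ _ ⟨hb, h.symm⟩) (@lt_asymm _ o.toPreorder i j h')

/-! ### The canonical linear extension of a heap -/

theorem strictlyLeft_or {i j : Fin n} (hne : i ≠ j) (h : ¬ H.Below i j) (h' : ¬ H.Below j i) :
    StrictlyLeft H.perm i j ∨ StrictlyLeft H.perm j i := by
  by_contra hc
  rw [not_or, ← crossing_pathOf] at hc
  exact (below_or_below hne hc).elim h h'

/-- A piece comparable to no element of an interval lies on the same side of both ends. -/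
theorem Below.strictlyLeft {i j k : Fin n} (h : H.Below i j) (hik : ¬ H.Below i k)
    (hkj : ¬ H.Below k j) :
    (StrictlyLeft H.perm i k → StrictlyLeft H.perm j k) ∧
      (StrictlyLeft H.perm k i → StrictlyLeft H.perm k j) := by
  have hle : ∀ {a}, Relation.ReflTransGen
      (fun a b => H.Below a b ∧ Crossing (pathOf H.perm a) (pathOf H.perm b)) a j →
      ¬ H.Below k a := by
    intro a ha
    induction ha using Relation.ReflTransGen.head_induction_on with
    | refl => exact hkj
    | head h1 _ ih => exact fun hk => ih (hk.trans h1.1)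
  -- Follow a chain of crossings up to `j`. All its pieces are incomparable to `k`, so each lies on
  -- one side of `k`. Changing sides in a link `a → c` would put `a` and `c` on opposite sides of
  -- `k`, although they cross.
  have main : ∀ {a}, Relation.ReflTransGen
      (fun a b => H.Below a b ∧ Crossing (pathOf H.perm a) (pathOf H.perm b)) a j →
      ¬ H.Below a k → (StrictlyLeft H.perm a k → StrictlyLeft H.perm j k) ∧
      (StrictlyLeft H.perm k a → StrictlyLeft H.perm k j) := by
    intro a ha
    induction ha using Relation.ReflTransGen.head_induction_on with
    | refl => exact fun _ => ⟨id, id⟩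
    | @head a c h1 h2 ih =>
      intro hak
      have hck : ¬ H.Below c k := fun hc => hak (h1.1.trans hc)
      have hne : c ≠ k := by
        rintro rfl
        exact hak h1.1
      have hcr := (crossing_pathOf _ _ _).1 h1.2
      have hs := strictlyLeft_or hne hck (hle h2)
      refine ⟨fun hl => (ih hck).1 (hs.resolve_right fun hr => hcr.1 (hl.trans hr)),
        fun hl => (ih hck).2 (hs.resolve_left fun hr => hcr.2 (hr.trans hl))⟩
  exact main h.transGen.to_reflTransGen hik

variable (H) in
/-- The total order on the pieces of a heap in which `i` precedes `j` if `i` is above `j`, or if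
`i` and `j` are incomparable and `i` is to the right of `j`. -/
def Precedes (i j : Fin n) : Prop :=
  H.Below j i ∨ (¬ H.Below i j ∧ StrictlyLeft H.perm j i)

theorem Precedes.irrefl (i : Fin n) : ¬ H.Precedes i i := by
  rintro (h | h)
  · exact H.below_irrefl i h
  · exact StrictlyLeft.irrefl i h.2

/-- If both relations come from the heap order, so does the result. In the other cases a failure
would put a piece on different sides of the two ends of an interval, against `Below.strictlyLeft`.
-/
theorem Precedes.trans {i j k : Fin n} (h : H.Precedes i j) (h' : H.Precedes j k) :
    H.Precedes i k := by
  by_cases hki : H.Below k i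
  · exact Or.inl hki
  rcases h with h | h <;> rcases h' with h' | h'
  · exact Or.inl (h'.trans h)
  · exact Or.inr ⟨fun hik => h'.1 (h.trans hik), (h.strictlyLeft h'.1 hki).2 h'.2⟩
  · have hik : ¬ H.Below i k := fun hik => h.1 (hik.trans h')
    refine Or.inr ⟨hik, ?_⟩
    have hne : k ≠ i := by
      rintro rfl
      exact h.1 h'
    refine (strictlyLeft_or hne hki hik).resolve_right fun hl => ?_
    exact StrictlyLeft.irrefl _ (((h'.strictlyLeft hki h.1).2 hl).trans h.2)
  · refine Or.inr ⟨fun hik => ?_, h'.2.trans h.2⟩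
    exact StrictlyLeft.irrefl _ (((hik.strictlyLeft h.1 h'.1).2 h.2).trans h'.2)

theorem precedes_or {i j : Fin n} (hne : i ≠ j) : H.Precedes i j ∨ H.Precedes j i := by
  by_cases h1 : H.Below i j
  · exact Or.inr (Or.inl h1)
  by_cases h2 : H.Below j i
  · exact Or.inl (Or.inl h2)
  rcases strictlyLeft_or hne h1 h2 with h | h
  · exact Or.inr (Or.inr ⟨h2, h⟩)
  · exact Or.inl (Or.inr ⟨h1, h⟩)

end PathHeap

/-! ### Pairs of permutations and heaps -/

theorem exists_equiv_of_strictTotal {X : Type*} [Fintype X] {n : ℕ} (hn : Fintype.card X = n)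
    (r : X → X → Prop) (irr : ∀ i, ¬ r i i) (tr : ∀ i j k, r i j → r j k → r i k)
    (tot : ∀ i j, i ≠ j → r i j ∨ r j i) :
    ∃ π : Fin n ≃ X, ∀ i j, r (π i) (π j) ↔ i < j := by
  classical
  have h1 : Std.Irrefl r := ⟨irr⟩
  have h2 : IsTrans X r := ⟨tr⟩
  have h3 : Std.Trichotomous r := ⟨fun i j h h' => by grind⟩
  have : IsStrictTotalOrder X r := {}
  let _ := linearOrderOfSTO r
  let e := monoEquivOfFin X hn
  exact ⟨e.toEquiv, fun i j => e.lt_iff_lt⟩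

/-- There is only one way to sort: `π'.symm ∘ π` is strictly monotone on `Fin n`, hence the
identity. -/
theorem perm_eq_of_forall_lt {n : ℕ} (r : Fin n → Fin n → Prop) (irr : ∀ i, ¬ r i i)
    (tr : ∀ i j k, r i j → r j k → r i k) (π π' : Equiv.Perm (Fin n))
    (h : ∀ i j, i < j → r (π i) (π j)) (h' : ∀ i j, i < j → r (π' i) (π' j)) : π = π' := by
  have hm : StrictMono (π'.symm ∘ π) := by
    intro i j hij
    by_contra hc
    rcases (not_lt.1 hc).lt_or_eq with hc | hc
    · have h1 := h' _ _ hc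
      simp only [Function.comp, Equiv.apply_symm_apply] at h1
      exact irr _ (tr _ _ _ h1 (h i j hij))
    · simp at hc
      omega
  ext i
  have := congrFun hm.eq_id i
  simp only [Function.comp, id, Equiv.symm_apply_eq] at this
  rw [this]

theorem existsUnique_pairToHeap {n : ℕ} (p : NoCommonRisePair n) :
    ∃! H : PathHeap n, PairToHeap p H := by
  obtain ⟨⟨π, ξ⟩, hp⟩ := p
  -- Later paths lie lower, so the rank has to decrease with the position. Positions are smaller
  -- than `n`, so the truncated subtraction is harmless.
  obtain ⟨H, hperm, hH⟩ := PathHeap.exists_of_rank (π.symm.trans ξ)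
    (fun a b => π.symm b < π.symm a) (fun a => n - (π.symm a : ℕ))
    (fun i j hne _ => by
      have : π.symm i ≠ π.symm j := fun h => hne (π.symm.injective h)
      omega)
    (fun i j h => by
      have := (π.symm i).2
      omega)
  refine ⟨H, ⟨fun i => by simp [hperm], fun i j hij hc => ?_⟩, ?_⟩
  · rw [hperm] at hc
    exact (hH _ _ hc.symm).2 (by simpa using hij)
  · rintro H' ⟨h1, h2⟩
    have hperm' : H'.perm = π.symm.trans ξ := by
      ext i
      have := h1 (π.symm i)
      simp at this
      simp [this]
    refine PathHeap.ext_of_crossing (hperm'.trans hperm.symm) fun i j hc => ?_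
    have hc' := hc
    rw [hperm'] at hc'
    rw [hH i j hc']
    have key : ∀ i j, Crossing (pathOf H'.perm i) (pathOf H'.perm j) →
        π.symm j < π.symm i → H'.Below i j := by
      intro i j hc hlt
      simpa using h2 (π.symm j) (π.symm i) hlt (by simpa using hc.symm)
    refine ⟨fun hb => ?_, key i j hc⟩
    by_contra hn
    rcases (not_lt.1 hn).lt_or_eq with hlt | heq
    · exact hb.not_below (key j i hc.symm hlt)
    · have : i = j := π.symm.injective heq
      subst this
      exact H'.below_irrefl i hb

/-- This forces the pair: a sequence without common rise is sorted by the canonical linear extension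
of its heap. The absence of a common rise settles neighbours, and an induction on the distance
propagates this to all incomparable pairs. -/
theorem PairToHeap.precedes {n : ℕ} {p : NoCommonRisePair n} {H : PathHeap n}
    (h : PairToHeap p H) (i j : Fin n) (hij : i < j) :
    H.Precedes (p.1.1 i) (p.1.1 j) := by
  obtain ⟨⟨π, ξ⟩, hp⟩ := p
  obtain ⟨h1, h2⟩ := h
  simp only at h1 h2 hp ⊢
  -- The heap order reverses positions: this holds for crossing pairs, and these generate the order.
  have hpos : ∀ {a b}, H.Below a b → π.symm b < π.symm a := by
    intro a b hab
    refine hab.of_crossing (r := fun a b => π.symm b < π.symm a) (fun _ _ _ h h' => h'.trans h) ?_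
    intro a b hb hc
    by_contra hn
    rcases (not_lt.1 hn).lt_or_eq with hlt | heq
    · have := h2 _ _ hlt (by simpa using hc)
      simp only [Equiv.apply_symm_apply] at this
      exact hb.not_below this
    · have : a = b := π.symm.injective heq
      subst this
      exact H.below_irrefl a hb
  have hnb : ∀ {i j}, i < j → ¬ H.Below (π i) (π j) := by
    intro i j hij hb
    have := hpos hb
    simp only [Equiv.symm_apply_apply] at this
    omega
  have hcons : ∀ i j : Fin n, (j : ℕ) = i + 1 → ¬ StrictlyLeft H.perm (π i) (π j) := by
    intro i j hij hl
    exact hp i j hij ⟨hl.1, by simpa [h1] using hl.2⟩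
  -- A piece at a later position is never above an earlier one. If it is not below either, the two
  -- are incomparable, and only the wrong side has to be excluded.
  suffices hs : ∀ d : ℕ, ∀ i j : Fin n, (j : ℕ) = i + 1 + d → ¬ H.Below (π j) (π i) →
      ¬ StrictlyLeft H.perm (π i) (π j) by
    by_cases hb : H.Below (π j) (π i)
    · exact Or.inl hb
    refine Or.inr ⟨hnb hij, ?_⟩
    refine (PathHeap.strictlyLeft_or (π.injective.ne hij.ne') hb (hnb hij)).resolve_right ?_
    exact hs (j - i - 1) i j (by omega) hb
  intro d
  induction d with
  | zero => exact fun i j hij _ => hcons i j hij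
  | succ d ih =>
    intro i j hij hb hl
    let k : Fin n := ⟨i + 1, by omega⟩
    have hik : i < k := Fin.lt_def.2 (Nat.lt_succ_self _)
    have hkj : k < j := Fin.lt_def.2 (show (i : ℕ) + 1 < j by omega)
    have hjk : (j : ℕ) = k + 1 + d := by show (j : ℕ) = i + 1 + 1 + d; omega
    -- Compare with the neighbour `k = i + 1`. If `π k` is below `π i`, then `π j` is incomparable
    -- to both, and by induction it is to the left of `π k`, hence to the left of `π i`. Otherwise
    -- `π k` is to the left of `π i` and so of `π j`; by induction `π j` must then be below `π k`,
    -- which puts `π i` on two sides of one interval.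
    by_cases hki : H.Below (π k) (π i)
    · have hbjk : ¬ H.Below (π j) (π k) := fun h => hb (h.trans hki)
      have hjk' := (PathHeap.strictlyLeft_or (π.injective.ne hkj.ne) (hnb hkj) hbjk).resolve_left
        (ih k j hjk hbjk)
      have := (hki.strictlyLeft (hnb hkj) hb).2 hjk'
      exact StrictlyLeft.irrefl _ (hl.trans this)
    · have hl' := (PathHeap.strictlyLeft_or (π.injective.ne hik.ne) (hnb hik) hki).resolve_left
        (hcons i k rfl)
      have hlk := hl'.trans hl
      by_cases hbjk : H.Below (π j) (π k)
      · have := (hbjk.strictlyLeft hb (hnb hik)).2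
        exact StrictlyLeft.irrefl _ (hl'.trans (this hl))
      · exact ih k j hjk hbjk hlk

/-- The pair lists the pieces in the order `H.Precedes`; uniqueness is `PairToHeap.precedes`. -/
theorem existsUnique_pair {n : ℕ} (H : PathHeap n) :
    ∃! p : NoCommonRisePair n, PairToHeap p H := by
  obtain ⟨π, hπ⟩ := exists_equiv_of_strictTotal (Fintype.card_fin n) H.Precedes PathHeap.Precedes.irrefl
    (fun _ _ _ => PathHeap.Precedes.trans) (fun _ _ => PathHeap.precedes_or)
  have hp : ∀ i j : Fin n, (j : ℕ) = (i : ℕ) + 1 →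
      ¬ (π i < π j ∧ π.trans H.perm i < π.trans H.perm j) := by
    intro i j hij hlt
    have hl : StrictlyLeft H.perm (π i) (π j) := hlt
    have hlt : i < j := by omega
    have hb : H.Below (π j) (π i) := by
      rcases (hπ i j).2 hlt with h | h
      · exact h
      · exact absurd (h.2.trans hl) (StrictlyLeft.irrefl _)
    -- A common rise at neighbours `i`, `j` would make `π j` lie below `π i` without crossing it.
    -- Some piece `c` would then be strictly between them in the heap, hence at a position strictly
    -- between `i` and `j`.
    obtain ⟨c, hjc, hcr, rfl | hci⟩ := hb.exists_crossing
    · exact ((crossing_pathOf _ _ _).1 hcr).2 hl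
    · have h1 : j > π.symm c := (hπ _ _).1 (by rw [Equiv.apply_symm_apply]; exact Or.inl hjc)
      have h2 : π.symm c > i := (hπ _ _).1 (by rw [Equiv.apply_symm_apply]; exact Or.inl hci)
      omega
  refine ⟨⟨(π, π.trans H.perm), hp⟩, ⟨fun i => rfl, fun i j hij hc => ?_⟩, ?_⟩
  · rcases (hπ i j).2 hij with h | h
    · exact h
    · exact absurd h.2 ((crossing_pathOf _ _ _).1 hc).2
  · intro p h
    have h1 : p.1.1 = π := perm_eq_of_forall_lt H.Precedes PathHeap.Precedes.irrefl
      (fun _ _ _ => PathHeap.Precedes.trans) _ _ h.precedes fun i j => (hπ i j).2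
    refine Subtype.ext (Prod.ext h1 (Equiv.ext fun i => ?_))
    rw [← h.1 i, h1]
    rfl

/-! ### Children in unions of sets of points -/

/-- No point of `B` shares a row or a column with a point of `C`. -/
def Apart (B C : Finset (ℕ × ℕ)) : Prop :=
  ∀ p ∈ B, ∀ q ∈ C, p.1 ≠ q.1 ∧ p.2 ≠ q.2

theorem Apart.symm {B C : Finset (ℕ × ℕ)} (h : Apart B C) : Apart C B :=
  fun p hp q hq => ⟨(h q hq p hp).1.symm, (h q hq p hp).2.symm⟩

theorem Apart.notMem {B C : Finset (ℕ × ℕ)} (h : Apart B C) {p : ℕ × ℕ} (hp : p ∈ B) : p ∉ C :=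
  fun hp' => (h p hp p hp').1 rfl

theorem Apart.isLeftChild_union {B C : Finset (ℕ × ℕ)} (h : Apart B C) (w c : ℕ × ℕ) :
    IsLeftChild (B ∪ C) w c ↔ IsLeftChild B w c ∨ IsLeftChild C w c := by
  simp only [IsLeftChild, Apart, Finset.mem_union] at *
  grind

theorem Apart.isRightChild_union {B C : Finset (ℕ × ℕ)} (h : Apart B C) (w c : ℕ × ℕ) :
    IsRightChild (B ∪ C) w c ↔ IsRightChild B w c ∨ IsRightChild C w c := by
  simp only [IsRightChild, Apart, Finset.mem_union] at *
  grind

theorem IsParent.mem_left {A : Finset (ℕ × ℕ)} {w c : ℕ × ℕ} (h : IsParent A w c) : w ∈ A :=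
  h.elim (fun h => h.1) (fun h => h.1)

theorem IsParent.mem_right {A : Finset (ℕ × ℕ)} {w c : ℕ × ℕ} (h : IsParent A w c) : c ∈ A :=
  h.elim (fun h => h.2.1) (fun h => h.2.1)

/-! ### Labelled binary trees -/

/-- Complete binary trees with leaves labelled by points. -/
inductive PointTree : Type
  | leaf (p : ℕ × ℕ) : PointTree
  | node (l r : PointTree) : PointTree

namespace PointTree

/-- The position of the root: the column of the leftmost leaf and the row of the rightmost leaf. -/
def corner : PointTree → ℕ × ℕ
  | leaf p => p
  | node l r => (l.corner.1, r.corner.2)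

/-- The positions of all vertices. -/
def points : PointTree → Finset (ℕ × ℕ)
  | leaf p => {p}
  | node l r => insert (l.corner.1, r.corner.2) (l.points ∪ r.points)

/-- The labels of the leaves. -/
def leaves : PointTree → Finset (ℕ × ℕ)
  | leaf p => {p}
  | node l r => l.leaves ∪ r.leaves

/-- The condition that the vertices form a non-ambiguous tree. -/
def Valid : PointTree → Prop
  | leaf _ => True
  | node l r => l.Valid ∧ r.Valid ∧ l.corner.1 < r.corner.1 ∧ r.corner.2 < l.corner.2 ∧
      Apart l.points r.points

theorem corner_mem (t : PointTree) : t.corner ∈ t.points := by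
  cases t <;> simp [corner, points]

theorem leaves_subset (t : PointTree) : t.leaves ⊆ t.points := by
  induction t with
  | leaf p => simp [leaves, points]
  | node l r ihl ihr =>
    simp only [leaves, points]
    exact (Finset.union_subset_union ihl ihr).trans (Finset.subset_insert _ _)

theorem exists_leaf_corner_fst (t : PointTree) : ∃ q ∈ t.leaves, q.1 = t.corner.1 := by
  induction t with
  | leaf p => simp [leaves, corner]
  | node l r _ _ =>
    simp only [leaves, corner, Finset.mem_union]
    grind

theorem exists_leaf_corner_snd (t : PointTree) : ∃ q ∈ t.leaves, q.2 = t.corner.2 := by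
  induction t with
  | leaf p => simp [leaves, corner]
  | node l r _ _ =>
    simp only [leaves, corner, Finset.mem_union]
    grind

/-- Each vertex lies in the column of the leftmost leaf of its subtree. Questions about occupied
columns thus reduce to the leaves. -/
theorem exists_leaf_fst {t : PointTree} {p : ℕ × ℕ} (hp : p ∈ t.points) :
    ∃ q ∈ t.leaves, q.1 = p.1 := by
  induction t with
  | leaf p => simp_all [leaves, points]
  | node l r ihl ihr =>
    have := l.exists_leaf_corner_fst
    simp only [leaves, points, Finset.mem_insert, Finset.mem_union] at *
    grind

theorem exists_leaf_snd {t : PointTree} {p : ℕ × ℕ} (hp : p ∈ t.points) :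
    ∃ q ∈ t.leaves, q.2 = p.2 := by
  induction t with
  | leaf p => simp_all [leaves, points]
  | node l r ihl ihr =>
    have := r.exists_leaf_corner_snd
    simp only [leaves, points, Finset.mem_insert, Finset.mem_union] at *
    grind

theorem apart_points {s t : PointTree} (h : Apart s.leaves t.leaves) :
    Apart s.points t.points := by
  intro p hp q hq
  obtain ⟨p1, hp1, e1⟩ := exists_leaf_fst hp
  obtain ⟨p2, hp2, e2⟩ := exists_leaf_snd hp
  obtain ⟨q1, hq1, e3⟩ := exists_leaf_fst hq
  obtain ⟨q2, hq2, e4⟩ := exists_leaf_snd hq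
  rw [← e1, ← e2, ← e3, ← e4]
  exact ⟨(h _ hp1 _ hq1).1, (h _ hp2 _ hq2).2⟩

theorem Valid.corner_le {t : PointTree} (ht : t.Valid) {p : ℕ × ℕ} (hp : p ∈ t.points) :
    t.corner.1 ≤ p.1 ∧ t.corner.2 ≤ p.2 := by
  induction t with
  | leaf q => simp_all [corner, points]
  | node l r ihl ihr =>
    simp only [points, Finset.mem_insert, Finset.mem_union, Valid, corner] at *
    rcases hp with rfl | hp | hp
    · simp
    · have := ihl ht.1 hp
      omega
    · have := ihr ht.2.1 hp
      omega

theorem Valid.corner_notMem {l r : PointTree} (h : (node l r).Valid) :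
    (l.corner.1, r.corner.2) ∉ l.points ∪ r.points := by
  have hl := h.1.corner_le (p := (l.corner.1, r.corner.2))
  have hr := h.2.1.corner_le (p := (l.corner.1, r.corner.2))
  simp only [Valid, Finset.mem_union] at *
  grind

/-- In its column the new corner meets only points of `l`, of which `l.corner` is the first. It
therefore becomes the nearest predecessor of `l.corner` and of nothing else, and no other parent
changes. -/
theorem Valid.isLeftChild_node {l r : PointTree} (h : (node l r).Valid) (w c : ℕ × ℕ) :
    IsLeftChild (node l r).points w c ↔
      IsLeftChild l.points w c ∨ IsLeftChild r.points w c ∨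
        (w = (l.corner.1, r.corner.2) ∧ c = l.corner) := by
  obtain ⟨hl, hr, h1, h2, ha⟩ := h
  have bl := fun p => hl.corner_le (p := p)
  have br := fun p => hr.corner_le (p := p)
  have cl := l.corner_mem
  have cr := r.corner_mem
  rw [← or_assoc, ← ha.isLeftChild_union]
  have hu : ∀ p ∈ l.points ∪ r.points, p.1 = l.corner.1 → l.corner.2 ≤ p.2 := by
    intro p hp e
    rcases Finset.mem_union.1 hp with hp | hp
    · exact (bl p hp).2
    · exact absurd e.symm (ha _ cl p hp).1
  have hc : l.corner ∈ l.points ∪ r.points := Finset.mem_union_left _ cl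
  simp only [points]
  generalize l.points ∪ r.points = B at hu hc
  simp only [IsLeftChild, Finset.mem_insert]
  generalize l.corner = a at *
  generalize r.corner = b at *
  obtain ⟨a1, a2⟩ := a
  obtain ⟨b1, b2⟩ := b
  obtain ⟨w1, w2⟩ := w
  obtain ⟨c1, c2⟩ := c
  clear bl br ha hl hr cl cr
  simp only [Prod.mk.injEq] at *
  constructor
  · grind
  · grind

theorem Valid.isRightChild_node {l r : PointTree} (h : (node l r).Valid) (w c : ℕ × ℕ) :
    IsRightChild (node l r).points w c ↔
      IsRightChild l.points w c ∨ IsRightChild r.points w c ∨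
        (w = (l.corner.1, r.corner.2) ∧ c = r.corner) := by
  obtain ⟨hl, hr, h1, h2, ha⟩ := h
  have br := fun p => hr.corner_le (p := p)
  have cr := r.corner_mem
  rw [← or_assoc, ← ha.isRightChild_union]
  have hu : ∀ p ∈ l.points ∪ r.points, p.2 = r.corner.2 → r.corner.1 ≤ p.1 := by
    intro p hp e
    rcases Finset.mem_union.1 hp with hp | hp
    · exact absurd e (ha p hp _ cr).2
    · exact (br p hp).1
  have hc : r.corner ∈ l.points ∪ r.points := Finset.mem_union_right _ cr
  simp only [points]
  generalize l.points ∪ r.points = B at hu hc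
  simp only [IsRightChild, Finset.mem_insert]
  generalize l.corner = a at *
  generalize r.corner = b at *
  obtain ⟨a1, a2⟩ := a
  obtain ⟨b1, b2⟩ := b
  obtain ⟨w1, w2⟩ := w
  obtain ⟨c1, c2⟩ := c
  clear br ha hl hr cr
  simp only [Prod.mk.injEq] at *
  constructor
  · grind
  · grind

theorem not_isLeftChild_leaf (p w c : ℕ × ℕ) : ¬ IsLeftChild (leaf p).points w c := by
  simp only [IsLeftChild, points, Finset.mem_singleton]
  rintro ⟨rfl, rfl, -, h, -⟩
  exact lt_irrefl _ h

theorem not_isRightChild_leaf (p w c : ℕ × ℕ) : ¬ IsRightChild (leaf p).points w c := by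
  simp only [IsRightChild, points, Finset.mem_singleton]
  rintro ⟨rfl, rfl, -, h, -⟩
  exact lt_irrefl _ h

theorem Valid.isParent_node {l r : PointTree} (h : (node l r).Valid) (w c : ℕ × ℕ) :
    IsParent (node l r).points w c ↔ IsParent l.points w c ∨ IsParent r.points w c ∨
        (w = (l.corner.1, r.corner.2) ∧ (c = l.corner ∨ c = r.corner)) := by
  simp only [IsParent, h.isLeftChild_node, h.isRightChild_node]
  tauto

end PointTree

/-! ### Descendants -/

theorem IsDescendant.mem {A : Finset (ℕ × ℕ)} {w u : ℕ × ℕ} (h : IsDescendant A w u)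
    (hw : w ∈ A) : u ∈ A := by
  induction h with
  | refl => exact hw
  | tail _ h _ => exact h.mem_right

/-- Descent from `w` only uses the children of points already reached, so it can be computed in a
part `B` that has the same children as `A`. -/
theorem isDescendant_congr {A B : Finset (ℕ × ℕ)} {w : ℕ × ℕ} (hw : w ∈ B)
    (h : ∀ p ∈ B, ∀ c, IsParent A p c ↔ IsParent B p c) (u : ℕ × ℕ) :
    IsDescendant A w u ↔ IsDescendant B w u := by
  constructor
  · intro hu
    suffices hs : IsDescendant B w u ∧ u ∈ B from hs.1
    induction hu with
    | refl => exact ⟨Relation.ReflTransGen.refl, hw⟩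
    | tail _ h1 ih =>
      have h2 := (h _ ih.2 _).1 h1
      exact ⟨ih.1.tail h2, h2.mem_right⟩
  · intro hu
    induction hu with
    | refl => exact Relation.ReflTransGen.refl
    | tail _ h1 ih => exact ih.tail ((h _ h1.mem_left _).2 h1)

theorem branchesAt_congr {A B : Finset (ℕ × ℕ)} {w : ℕ × ℕ} (hw : w ∈ B)
    (hl : ∀ p ∈ B, ∀ c, IsLeftChild A p c ↔ IsLeftChild B p c)
    (hr : ∀ p ∈ B, ∀ c, IsRightChild A p c ↔ IsRightChild B p c) (u v : ℕ × ℕ) :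
    BranchesAt A w u v ↔ BranchesAt B w u v := by
  have hp : ∀ p ∈ B, ∀ c, IsParent A p c ↔ IsParent B p c := fun p hp c =>
    or_congr (hl p hp c) (hr p hp c)
  refine and_congr (exists_congr fun c => ?_) (exists_congr fun c => ?_)
  · rw [hl w hw]
    exact and_congr_right fun h => isDescendant_congr h.2.1 hp u
  · rw [hr w hw]
    exact and_congr_right fun h => isDescendant_congr h.2.1 hp v

theorem BranchesAt.mem {A : Finset (ℕ × ℕ)} {w u v : ℕ × ℕ} (h : BranchesAt A w u v) :
    w ∈ A ∧ u ∈ A ∧ v ∈ A := by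
  obtain ⟨⟨c, hc, hu⟩, ⟨d, hd, hv⟩⟩ := h
  exact ⟨hc.1, hu.mem hc.2.1, hv.mem hd.2.1⟩

/-- `w` is a left child, or a root if `b` holds. -/
def IsLeftType (b : Prop) (A : Finset (ℕ × ℕ)) (w : ℕ × ℕ) : Prop :=
  b ∧ IsRoot A w ∨ ∃ p, IsLeftChild A p w

/-- `w` is a right child, or a root if `b` holds. -/
def IsRightType (b : Prop) (A : Finset (ℕ × ℕ)) (w : ℕ × ℕ) : Prop :=
  b ∧ IsRoot A w ∨ ∃ p, IsRightChild A p w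

/-- The order of the leaves inside the trees, where the roots are treated as left children if `b`
holds and as right children otherwise. -/
def BelowWithin (b : Prop) (A : Finset (ℕ × ℕ)) (u v : ℕ × ℕ) : Prop :=
  (∃ w, IsLeftType b A w ∧ BranchesAt A w v u) ∨ (∃ w, IsRightType (¬ b) A w ∧ BranchesAt A w u v)

theorem BelowWithin.mem {b : Prop} {A : Finset (ℕ × ℕ)} {u v : ℕ × ℕ} (h : BelowWithin b A u v) :
    u ∈ A ∧ v ∈ A := by
  rcases h with ⟨w, -, h⟩ | ⟨w, -, h⟩
  · exact ⟨h.mem.2.2, h.mem.2.1⟩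
  · exact h.mem.2

theorem leafBelow_iff (A : Finset (ℕ × ℕ)) (u v : ℕ × ℕ) : LeafBelow A u v ↔
    (∃ r r', IsRoot A r ∧ IsRoot A r' ∧ IsDescendant A r u ∧ IsDescendant A r' v ∧ r.1 < r'.1) ∨
      BelowWithin True A u v := by
  simp [LeafBelow, BelowWithin, IsLeftType, IsRightType]

/-! ### Disjoint unions -/

namespace Apart

variable {B C : Finset (ℕ × ℕ)}

theorem isParent_union (h : Apart B C) (w c : ℕ × ℕ) :
    IsParent (B ∪ C) w c ↔ IsParent B w c ∨ IsParent C w c := by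
  simp only [IsParent, h.isLeftChild_union, h.isRightChild_union]
  tauto

theorem isLeftChild_iff (h : Apart B C) {w : ℕ × ℕ} (hw : w ∈ B) (c : ℕ × ℕ) :
    IsLeftChild (B ∪ C) w c ↔ IsLeftChild B w c := by
  rw [h.isLeftChild_union]
  exact or_iff_left fun h' => h.notMem hw h'.1

theorem isRightChild_iff (h : Apart B C) {w : ℕ × ℕ} (hw : w ∈ B) (c : ℕ × ℕ) :
    IsRightChild (B ∪ C) w c ↔ IsRightChild B w c := by
  rw [h.isRightChild_union]
  exact or_iff_left fun h' => h.notMem hw h'.1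

theorem isDescendant_iff (h : Apart B C) {w : ℕ × ℕ} (hw : w ∈ B) (u : ℕ × ℕ) :
    IsDescendant (B ∪ C) w u ↔ IsDescendant B w u :=
  isDescendant_congr hw (fun _ hp c => or_congr (h.isLeftChild_iff hp c) (h.isRightChild_iff hp c))
    u

theorem isRoot_iff (h : Apart B C) {w : ℕ × ℕ} (hw : w ∈ B) :
    IsRoot (B ∪ C) w ↔ IsRoot B w := by
  simp only [IsRoot, h.isParent_union, Finset.mem_union, hw, true_or, true_and]
  exact forall_congr' fun p => not_congr (or_iff_left fun h' => h.notMem hw h'.mem_right)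

theorem branchesAt_iff (h : Apart B C) {w : ℕ × ℕ} (hw : w ∈ B) (u v : ℕ × ℕ) :
    BranchesAt (B ∪ C) w u v ↔ BranchesAt B w u v :=
  branchesAt_congr hw (fun _ hp c => h.isLeftChild_iff hp c)
    (fun _ hp c => h.isRightChild_iff hp c) u v

theorem isLeftType_iff (h : Apart B C) {b : Prop} {w : ℕ × ℕ} (hw : w ∈ B) :
    IsLeftType b (B ∪ C) w ↔ IsLeftType b B w := by
  refine or_congr (and_congr_right fun _ => h.isRoot_iff hw) (exists_congr fun p => ?_)
  rw [h.isLeftChild_union]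
  exact or_iff_left fun h' => h.notMem hw h'.2.1

theorem isRightType_iff (h : Apart B C) {b : Prop} {w : ℕ × ℕ} (hw : w ∈ B) :
    IsRightType b (B ∪ C) w ↔ IsRightType b B w := by
  refine or_congr (and_congr_right fun _ => h.isRoot_iff hw) (exists_congr fun p => ?_)
  rw [h.isRightChild_union]
  exact or_iff_left fun h' => h.notMem hw h'.2.1

theorem belowWithin_union (h : Apart B C) (b : Prop) (u v : ℕ × ℕ) :
    BelowWithin b (B ∪ C) u v ↔ BelowWithin b B u v ∨ BelowWithin b C u v := by
  have hC := h.symm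
  constructor
  · rintro (⟨w, hw, hb⟩ | ⟨w, hw, hb⟩) <;> rcases Finset.mem_union.1 hb.mem.1 with hm | hm
    · exact Or.inl (Or.inl ⟨w, (h.isLeftType_iff hm).1 hw, (h.branchesAt_iff hm _ _).1 hb⟩)
    · rw [Finset.union_comm] at hw hb
      exact Or.inr (Or.inl ⟨w, (hC.isLeftType_iff hm).1 hw, (hC.branchesAt_iff hm _ _).1 hb⟩)
    · exact Or.inl (Or.inr ⟨w, (h.isRightType_iff hm).1 hw, (h.branchesAt_iff hm _ _).1 hb⟩)
    · rw [Finset.union_comm] at hw hb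
      exact Or.inr (Or.inr ⟨w, (hC.isRightType_iff hm).1 hw, (hC.branchesAt_iff hm _ _).1 hb⟩)
  · rintro ((⟨w, hw, hb⟩ | ⟨w, hw, hb⟩) | (⟨w, hw, hb⟩ | ⟨w, hw, hb⟩)) <;> have hm := hb.mem.1
    · exact Or.inl ⟨w, (h.isLeftType_iff hm).2 hw, (h.branchesAt_iff hm _ _).2 hb⟩
    · exact Or.inr ⟨w, (h.isRightType_iff hm).2 hw, (h.branchesAt_iff hm _ _).2 hb⟩
    · rw [Finset.union_comm]
      exact Or.inl ⟨w, (hC.isLeftType_iff hm).2 hw, (hC.branchesAt_iff hm _ _).2 hb⟩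
    · rw [Finset.union_comm]
      exact Or.inr ⟨w, (hC.isRightType_iff hm).2 hw, (hC.branchesAt_iff hm _ _).2 hb⟩

end Apart

/-! ### The tree structure of the points of a labelled tree -/

namespace PointTree

variable {l r : PointTree}

theorem Valid.ne_corner_left (h : (node l r).Valid) {w : ℕ × ℕ} (hw : w ∈ l.points) :
    w ≠ (l.corner.1, r.corner.2) := by
  rintro rfl
  exact h.corner_notMem (Finset.mem_union_left _ hw)

theorem Valid.ne_corner_right (h : (node l r).Valid) {w : ℕ × ℕ} (hw : w ∈ r.points) :
    w ≠ (l.corner.1, r.corner.2) := by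
  rintro rfl
  exact h.corner_notMem (Finset.mem_union_right _ hw)

theorem Valid.isLeftChild_left (h : (node l r).Valid) {w : ℕ × ℕ} (hw : w ∈ l.points)
    (c : ℕ × ℕ) : IsLeftChild (node l r).points w c ↔ IsLeftChild l.points w c := by
  rw [h.isLeftChild_node]
  have h1 := h.ne_corner_left hw
  have h2 : ¬ IsLeftChild r.points w c := fun h' => h.2.2.2.2.notMem hw h'.1
  tauto

theorem Valid.isLeftChild_right (h : (node l r).Valid) {w : ℕ × ℕ} (hw : w ∈ r.points)
    (c : ℕ × ℕ) : IsLeftChild (node l r).points w c ↔ IsLeftChild r.points w c := by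
  rw [h.isLeftChild_node]
  have h1 := h.ne_corner_right hw
  have h2 : ¬ IsLeftChild l.points w c := fun h' => h.2.2.2.2.notMem h'.1 hw
  tauto

theorem Valid.isRightChild_left (h : (node l r).Valid) {w : ℕ × ℕ} (hw : w ∈ l.points)
    (c : ℕ × ℕ) : IsRightChild (node l r).points w c ↔ IsRightChild l.points w c := by
  rw [h.isRightChild_node]
  have h1 := h.ne_corner_left hw
  have h2 : ¬ IsRightChild r.points w c := fun h' => h.2.2.2.2.notMem hw h'.1
  tauto

theorem Valid.isRightChild_right (h : (node l r).Valid) {w : ℕ × ℕ} (hw : w ∈ r.points)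
    (c : ℕ × ℕ) : IsRightChild (node l r).points w c ↔ IsRightChild r.points w c := by
  rw [h.isRightChild_node]
  have h1 := h.ne_corner_right hw
  have h2 : ¬ IsRightChild l.points w c := fun h' => h.2.2.2.2.notMem h'.1 hw
  tauto

theorem Valid.isDescendant_left (h : (node l r).Valid) {w : ℕ × ℕ} (hw : w ∈ l.points)
    (u : ℕ × ℕ) : IsDescendant (node l r).points w u ↔ IsDescendant l.points w u :=
  isDescendant_congr hw
    (fun _ hp c => or_congr (h.isLeftChild_left hp c) (h.isRightChild_left hp c)) u

theorem Valid.isDescendant_right (h : (node l r).Valid) {w : ℕ × ℕ} (hw : w ∈ r.points)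
    (u : ℕ × ℕ) : IsDescendant (node l r).points w u ↔ IsDescendant r.points w u :=
  isDescendant_congr hw
    (fun _ hp c => or_congr (h.isLeftChild_right hp c) (h.isRightChild_right hp c)) u

theorem Valid.isDescendant_corner {t : PointTree} (h : t.Valid) (u : ℕ × ℕ) :
    IsDescendant t.points t.corner u ↔ u ∈ t.points := by
  refine ⟨fun h' => h'.mem t.corner_mem, fun hu => ?_⟩
  induction t with
  | leaf p =>
    obtain rfl : u = p := by simpa [points] using hu
    exact Relation.ReflTransGen.refl
  | node l r ihl ihr =>
    simp only [points, Finset.mem_insert, Finset.mem_union] at hu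
    rcases hu with rfl | hu | hu
    · exact Relation.ReflTransGen.refl
    · exact Relation.ReflTransGen.head
        ((h.isParent_node _ _).2 (Or.inr (Or.inr ⟨rfl, Or.inl rfl⟩)))
        ((h.isDescendant_left l.corner_mem _).2 (ihl h.1 hu))
    · exact Relation.ReflTransGen.head
        ((h.isParent_node _ _).2 (Or.inr (Or.inr ⟨rfl, Or.inr rfl⟩)))
        ((h.isDescendant_right r.corner_mem _).2 (ihr h.2.1 hu))

theorem Valid.isRoot_iff {t : PointTree} (h : t.Valid) (w : ℕ × ℕ) :
    IsRoot t.points w ↔ w = t.corner := by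
  constructor
  · rintro ⟨hw, hp⟩
    have := (h.isDescendant_corner w).2 hw
    rcases Relation.ReflTransGen.cases_tail this with h1 | ⟨p, -, h1⟩
    · exact h1
    · exact absurd h1 (hp p)
  · rintro rfl
    refine ⟨t.corner_mem, fun p hp => ?_⟩
    have := h.corner_le hp.mem_left
    rcases hp with hp | hp
    · have := hp.2.2.2.1
      omega
    · have := hp.2.2.2.1
      omega

theorem Valid.branchesAt_left (h : (node l r).Valid) {w : ℕ × ℕ} (hw : w ∈ l.points)
    (u v : ℕ × ℕ) : BranchesAt (node l r).points w u v ↔ BranchesAt l.points w u v :=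
  branchesAt_congr hw (fun _ hp c => h.isLeftChild_left hp c)
    (fun _ hp c => h.isRightChild_left hp c) u v

theorem Valid.branchesAt_right (h : (node l r).Valid) {w : ℕ × ℕ} (hw : w ∈ r.points)
    (u v : ℕ × ℕ) : BranchesAt (node l r).points w u v ↔ BranchesAt r.points w u v :=
  branchesAt_congr hw (fun _ hp c => h.isLeftChild_right hp c)
    (fun _ hp c => h.isRightChild_right hp c) u v

theorem Valid.branchesAt_corner (h : (node l r).Valid) (u v : ℕ × ℕ) :
    BranchesAt (node l r).points (l.corner.1, r.corner.2) u v ↔ u ∈ l.points ∧ v ∈ r.points := by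
  have hl : ∀ c, IsLeftChild (node l r).points (l.corner.1, r.corner.2) c ↔ c = l.corner := by
    intro c
    rw [h.isLeftChild_node]
    have h1 : ¬ IsLeftChild l.points (l.corner.1, r.corner.2) c :=
      fun h' => h.ne_corner_left h'.1 rfl
    have h2 : ¬ IsLeftChild r.points (l.corner.1, r.corner.2) c :=
      fun h' => h.ne_corner_right h'.1 rfl
    tauto
  have hr : ∀ c, IsRightChild (node l r).points (l.corner.1, r.corner.2) c ↔ c = r.corner := by
    intro c
    rw [h.isRightChild_node]
    have h1 : ¬ IsRightChild l.points (l.corner.1, r.corner.2) c :=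
      fun h' => h.ne_corner_left h'.1 rfl
    have h2 : ¬ IsRightChild r.points (l.corner.1, r.corner.2) c :=
      fun h' => h.ne_corner_right h'.1 rfl
    tauto
  simp only [BranchesAt, hl, hr, exists_eq_left, h.isDescendant_left l.corner_mem,
    h.isDescendant_right r.corner_mem, h.1.isDescendant_corner, h.2.1.isDescendant_corner]

theorem Valid.isLeftType_corner (h : (node l r).Valid) (b : Prop) :
    IsLeftType b (node l r).points (l.corner.1, r.corner.2) ↔ b := by
  have hr : IsRoot (node l r).points (l.corner.1, r.corner.2) := (h.isRoot_iff _).2 rfl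
  have : ¬ ∃ p, IsLeftChild (node l r).points p (l.corner.1, r.corner.2) :=
    fun ⟨p, hp⟩ => hr.2 p (Or.inl hp)
  simp only [IsLeftType]
  tauto

theorem Valid.isRightType_corner (h : (node l r).Valid) (b : Prop) :
    IsRightType b (node l r).points (l.corner.1, r.corner.2) ↔ b := by
  have hr : IsRoot (node l r).points (l.corner.1, r.corner.2) := (h.isRoot_iff _).2 rfl
  have : ¬ ∃ p, IsRightChild (node l r).points p (l.corner.1, r.corner.2) :=
    fun ⟨p, hp⟩ => hr.2 p (Or.inr hp)
  simp only [IsRightType]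
  tauto

/-- The flag `b` of the whole tree only concerns its own corner. The corner of `l`, a root of
`l.points`, becomes a left child, whence `True`. In the next two lemmas the flag is `False` because
the roots concerned become children of the opposite kind. -/
theorem Valid.isLeftType_left (h : (node l r).Valid) (b : Prop) {w : ℕ × ℕ} (hw : w ∈ l.points) :
    IsLeftType b (node l r).points w ↔ IsLeftType True l.points w := by
  have h1 := h.ne_corner_left hw
  have h2 : ∀ p, ¬ IsLeftChild r.points p w := fun p h' => h.2.2.2.2.notMem hw h'.2.1
  simp [IsLeftType, h.isRoot_iff, h.1.isRoot_iff, h.isLeftChild_node, corner, h1, h2, exists_or,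
    or_comm]

theorem Valid.isLeftType_right (h : (node l r).Valid) (b : Prop) {w : ℕ × ℕ}
    (hw : w ∈ r.points) : IsLeftType b (node l r).points w ↔ IsLeftType False r.points w := by
  have h1 := h.ne_corner_right hw
  have h2 : ∀ p, ¬ IsLeftChild l.points p w := fun p h' => h.2.2.2.2.notMem h'.2.1 hw
  have h3 : w ≠ l.corner := fun h' => h.2.2.2.2.notMem l.corner_mem (h' ▸ hw)
  simp [IsLeftType, h.isRoot_iff, h.isLeftChild_node, corner, h1, h2, h3]

theorem Valid.isRightType_left (h : (node l r).Valid) (b : Prop) {w : ℕ × ℕ}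
    (hw : w ∈ l.points) : IsRightType b (node l r).points w ↔ IsRightType False l.points w := by
  have h1 := h.ne_corner_left hw
  have h2 : ∀ p, ¬ IsRightChild r.points p w := fun p h' => h.2.2.2.2.notMem hw h'.2.1
  have h3 : w ≠ r.corner := fun h' => h.2.2.2.2.notMem (h' ▸ hw) r.corner_mem
  simp [IsRightType, h.isRoot_iff, h.isRightChild_node, corner, h1, h2, h3]

theorem Valid.isRightType_right (h : (node l r).Valid) (b : Prop) {w : ℕ × ℕ}
    (hw : w ∈ r.points) : IsRightType b (node l r).points w ↔ IsRightType True r.points w := by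
  have h1 := h.ne_corner_right hw
  have h2 : ∀ p, ¬ IsRightChild l.points p w := fun p h' => h.2.2.2.2.notMem h'.2.1 hw
  simp [IsRightType, h.isRoot_iff, h.2.1.isRoot_iff, h.isRightChild_node, corner, h1, h2,
    exists_or, or_comm]

theorem not_belowWithin_leaf (b : Prop) (p u v : ℕ × ℕ) :
    ¬ BelowWithin b (leaf p).points u v := by
  rintro (⟨w, -, ⟨c, hc, -⟩, -⟩ | ⟨w, -, ⟨c, hc, -⟩, -⟩)
  · exact not_isLeftChild_leaf _ _ _ hc
  · exact not_isLeftChild_leaf _ _ _ hc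

theorem mem_points_node {w : ℕ × ℕ} : w ∈ (node l r).points ↔
    w = (l.corner.1, r.corner.2) ∨ w ∈ l.points ∨ w ∈ r.points := by
  simp [points]

/-- The recursion behind the correspondence: inside the subtrees the order is that of a tree whose
root counts as a left child (for `l`) or as a right child (for `r`), and `b` decides which of the
two subtrees lies below the other. -/
theorem Valid.belowWithin_node (h : (node l r).Valid) (b : Prop) (u v : ℕ × ℕ) :
    BelowWithin b (node l r).points u v ↔
      BelowWithin True l.points u v ∨ BelowWithin False r.points u v ∨
        (b ∧ v ∈ l.points ∧ u ∈ r.points) ∨ (¬ b ∧ u ∈ l.points ∧ v ∈ r.points) := by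
  constructor
  · rintro (⟨w, hw, hb⟩ | ⟨w, hw, hb⟩) <;> rcases mem_points_node.1 hb.mem.1 with rfl | hm | hm
    · exact Or.inr (Or.inr (Or.inl
        ⟨(h.isLeftType_corner _).1 hw, (h.branchesAt_corner _ _).1 hb⟩))
    · exact Or.inl (Or.inl ⟨w, (h.isLeftType_left _ hm).1 hw, (h.branchesAt_left hm _ _).1 hb⟩)
    · exact Or.inr (Or.inl (Or.inl
        ⟨w, (h.isLeftType_right _ hm).1 hw, (h.branchesAt_right hm _ _).1 hb⟩))
    · exact Or.inr (Or.inr (Or.inr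
        ⟨(h.isRightType_corner _).1 hw, (h.branchesAt_corner _ _).1 hb⟩))
    · refine Or.inl (Or.inr ⟨w, ?_, (h.branchesAt_left hm _ _).1 hb⟩)
      rw [not_true]
      exact (h.isRightType_left _ hm).1 hw
    · refine Or.inr (Or.inl (Or.inr ⟨w, ?_, (h.branchesAt_right hm _ _).1 hb⟩))
      rw [not_false_iff]
      exact (h.isRightType_right _ hm).1 hw
  · rintro ((⟨w, hw, hb⟩ | ⟨w, hw, hb⟩) | (⟨w, hw, hb⟩ | ⟨w, hw, hb⟩) | ⟨h1, h2⟩ | ⟨h1, h2⟩)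
    · exact Or.inl ⟨w, (h.isLeftType_left _ hb.mem.1).2 hw, (h.branchesAt_left hb.mem.1 _ _).2 hb⟩
    · rw [not_true] at hw
      exact Or.inr
        ⟨w, (h.isRightType_left _ hb.mem.1).2 hw, (h.branchesAt_left hb.mem.1 _ _).2 hb⟩
    · exact Or.inl
        ⟨w, (h.isLeftType_right _ hb.mem.1).2 hw, (h.branchesAt_right hb.mem.1 _ _).2 hb⟩
    · rw [not_false_iff] at hw
      exact Or.inr
        ⟨w, (h.isRightType_right _ hb.mem.1).2 hw, (h.branchesAt_right hb.mem.1 _ _).2 hb⟩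
    · exact Or.inl ⟨_, (h.isLeftType_corner _).2 h1, (h.branchesAt_corner _ _).2 h2⟩
    · exact Or.inr ⟨_, (h.isRightType_corner _).2 h1, (h.branchesAt_corner _ _).2 h2⟩

end PointTree

/-! ### Leaves and completeness -/

/-- Every point of `A` is either in `L` and without children, or not in `L` and with two
children. -/
def HasLeaves (A L : Finset (ℕ × ℕ)) : Prop :=
  L ⊆ A ∧ ∀ w ∈ A, (w ∈ L ∧ ∀ c, ¬ IsParent A w c) ∨
    (w ∉ L ∧ (∃ c, IsLeftChild A w c) ∧ ∃ d, IsRightChild A w d)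

/-- No point of `A` has both a point of `A` below it in its column and a point of `A` to its left
in its row. -/
def NotBoth (A : Finset (ℕ × ℕ)) : Prop :=
  ∀ p ∈ A, ¬ ((∃ q ∈ A, q.1 = p.1 ∧ q.2 < p.2) ∧ (∃ s ∈ A, s.2 = p.2 ∧ s.1 < p.1))

theorem IsLeftChild.unique {A : Finset (ℕ × ℕ)} {w c d : ℕ × ℕ} (h : IsLeftChild A w c)
    (h' : IsLeftChild A w d) : c = d := by
  obtain ⟨-, h1, h2, h3, h4⟩ := h
  obtain ⟨-, h1', h2', h3', h4'⟩ := h'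
  have := h4 d h1'
  have := h4' c h1
  exact Prod.ext (by omega) (by omega)

theorem IsRightChild.unique {A : Finset (ℕ × ℕ)} {w c d : ℕ × ℕ} (h : IsRightChild A w c)
    (h' : IsRightChild A w d) : c = d := by
  obtain ⟨-, h1, h2, h3, h4⟩ := h
  obtain ⟨-, h1', h2', h3', h4'⟩ := h'
  have := h4 d h1'
  have := h4' c h1
  exact Prod.ext (by omega) (by omega)

theorem mem_childrenIn {A : Finset (ℕ × ℕ)} {w c : ℕ × ℕ} : c ∈ childrenIn A w ↔ IsParent A w c := by
  simp only [childrenIn, Finset.mem_filter, and_iff_right_iff_imp]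
  exact IsParent.mem_right

theorem mem_leavesOf {A : Finset (ℕ × ℕ)} {w : ℕ × ℕ} :
    w ∈ leavesOf A ↔ w ∈ A ∧ ∀ c, ¬ IsParent A w c := by
  simp [leavesOf, Finset.eq_empty_iff_forall_notMem, mem_childrenIn]

/-- A vertex has at most one child of each kind. -/
theorem card_childrenIn_eq_two_iff {A : Finset (ℕ × ℕ)} {w : ℕ × ℕ} :
    (childrenIn A w).card = 2 ↔ (∃ c, IsLeftChild A w c) ∧ ∃ d, IsRightChild A w d := by
  constructor
  · intro h
    obtain ⟨c, d, hne, he⟩ := Finset.card_eq_two.1 h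
    have hc : IsParent A w c := mem_childrenIn.1 (by simp [he])
    have hd : IsParent A w d := mem_childrenIn.1 (by simp [he])
    rcases hc with hc | hc <;> rcases hd with hd | hd
    · exact absurd (hc.unique hd) hne
    · exact ⟨⟨c, hc⟩, ⟨d, hd⟩⟩
    · exact ⟨⟨d, hd⟩, ⟨c, hc⟩⟩
    · exact absurd (hc.unique hd) hne
  · rintro ⟨⟨c, hc⟩, ⟨d, hd⟩⟩
    refine Finset.card_eq_two.2 ⟨c, d, ?_, ?_⟩
    · rintro rfl
      have h1 := hc.2.2.1
      have h2 := hd.2.2.2.1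
      omega
    · ext e
      simp only [mem_childrenIn, Finset.mem_insert, Finset.mem_singleton]
      constructor
      · rintro (h | h)
        · exact Or.inl (h.unique hc)
        · exact Or.inr (h.unique hd)
      · rintro (rfl | rfl)
        · exact Or.inl hc
        · exact Or.inr hd

theorem HasLeaves.leavesOf_eq {A L : Finset (ℕ × ℕ)} (h : HasLeaves A L) : leavesOf A = L := by
  ext w
  rw [mem_leavesOf]
  constructor
  · rintro ⟨hw, hc⟩
    rcases h.2 w hw with h' | ⟨-, ⟨c, h'⟩, -⟩
    · exact h'.1
    · exact absurd (Or.inl h') (hc c)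
  · intro hw
    exact ⟨h.1 hw, ((h.2 w (h.1 hw)).resolve_right fun h' => h'.1 hw).2⟩

theorem HasLeaves.complete {A L : Finset (ℕ × ℕ)} (h : HasLeaves A L) (w : ℕ × ℕ) (hw : w ∈ A) :
    (childrenIn A w).card = 0 ∨ (childrenIn A w).card = 2 := by
  rcases h.2 w hw with h' | h'
  · left
    rw [Finset.card_eq_zero, Finset.eq_empty_iff_forall_notMem]
    exact fun c hc => h'.2 c (mem_childrenIn.1 hc)
  · exact Or.inr (card_childrenIn_eq_two_iff.2 h'.2)

theorem Apart.notBoth {B C : Finset (ℕ × ℕ)} (h : Apart B C) (hB : NotBoth B) (hC : NotBoth C) :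
    NotBoth (B ∪ C) := by
  simp only [NotBoth, Apart, Finset.mem_union] at *
  grind

theorem Apart.hasLeaves {B C L M : Finset (ℕ × ℕ)} (h : Apart B C) (hB : HasLeaves B L)
    (hC : HasLeaves C M) : HasLeaves (B ∪ C) (L ∪ M) := by
  refine ⟨Finset.union_subset_union hB.1 hC.1, fun w hw => ?_⟩
  have h1 : w ∈ L → w ∈ B := fun h => hB.1 h
  have h2 : w ∈ M → w ∈ C := fun h => hC.1 h
  have h3 : w ∈ B → w ∉ C := fun h' => h.notMem h'
  have h4 := hB.2 w
  have h5 := hC.2 w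
  have h6 : ∀ {c}, IsParent B w c → w ∈ B := IsParent.mem_left
  have h7 : ∀ {c}, IsParent C w c → w ∈ C := IsParent.mem_left
  simp only [h.isParent_union, h.isLeftChild_union, h.isRightChild_union, Finset.mem_union] at *
  rcases hw with hw | hw
  · rcases h4 hw with h4 | ⟨h4, ⟨c, hc⟩, ⟨d, hd⟩⟩
    · exact Or.inl ⟨Or.inl h4.1, fun c hc => hc.elim (h4.2 c) fun h => h3 hw (h7 h)⟩
    · exact Or.inr ⟨by tauto, ⟨c, Or.inl hc⟩, ⟨d, Or.inl hd⟩⟩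
  · rcases h5 hw with h5 | ⟨h5, ⟨c, hc⟩, ⟨d, hd⟩⟩
    · exact Or.inl ⟨Or.inr h5.1, fun c hc => hc.elim (fun h => h3 (h6 h) hw) (h5.2 c)⟩
    · exact Or.inr ⟨by tauto, ⟨c, Or.inr hc⟩, ⟨d, Or.inr hd⟩⟩

namespace PointTree

/-- The new corner could only spoil points in its own column or row. A point of `l` in that column
is in the first column of `l`, and so has nothing to its left in its row; dually for a point of `r`
in that row. -/
theorem Valid.notBoth {t : PointTree} (h : t.Valid) : NotBoth t.points := by
  induction t with
  | leaf p =>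
    simp only [NotBoth, points, Finset.mem_singleton]
    rintro _ rfl ⟨⟨_, rfl, -, h⟩, -⟩
    exact lt_irrefl _ h
  | node l r ihl ihr =>
    have hu := h.2.2.2.2.notBoth (ihl h.1) (ihr h.2.1)
    have bl := fun p => h.1.corner_le (p := p)
    have br := fun p => h.2.1.corner_le (p := p)
    have cl := l.corner_mem
    have cr := r.corner_mem
    obtain ⟨-, -, h1, h2, ha⟩ := h
    simp only [NotBoth, Apart, points, Finset.mem_insert, Finset.mem_union] at *
    generalize l.corner = a at *
    generalize r.corner = b at *
    rintro p hp ⟨⟨q, hq, e1, h3⟩, ⟨s, hs, e2, h4⟩⟩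
    rcases hp with rfl | hp | hp
    · grind
    · grind
    · grind

theorem Valid.hasLeaves {t : PointTree} (h : t.Valid) : HasLeaves t.points t.leaves := by
  induction t with
  | leaf p =>
    refine ⟨subset_rfl, fun w hw => Or.inl ⟨hw, ?_⟩⟩
    rintro c (hc | hc)
    · exact not_isLeftChild_leaf _ _ _ hc
    · exact not_isRightChild_leaf _ _ _ hc
  | node l r ihl ihr =>
    have hu := h.2.2.2.2.hasLeaves (ihl h.1) (ihr h.2.1)
    refine ⟨hu.1.trans (Finset.subset_insert _ _), fun w hw => ?_⟩
    rcases mem_points_node.1 hw with rfl | hm | hm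
    · exact Or.inr ⟨fun h' => h.corner_notMem (hu.1 h'),
        ⟨_, (h.isLeftChild_node _ _).2 (Or.inr (Or.inr ⟨rfl, rfl⟩))⟩,
        ⟨_, (h.isRightChild_node _ _).2 (Or.inr (Or.inr ⟨rfl, rfl⟩))⟩⟩
    · have := hu.2 w (Finset.mem_union_left _ hm)
      simpa only [IsParent, h.isLeftChild_left hm, h.isRightChild_left hm,
        h.2.2.2.2.isLeftChild_iff hm, h.2.2.2.2.isRightChild_iff hm, leaves] using this
    · have := hu.2 w (Finset.mem_union_right _ hm)
      rw [Finset.union_comm l.points] at this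
      simpa only [IsParent, h.isLeftChild_right hm, h.isRightChild_right hm,
        h.2.2.2.2.symm.isLeftChild_iff hm, h.2.2.2.2.symm.isRightChild_iff hm, leaves]
        using this

end PointTree

/-! ### Forests of labelled trees -/

open PointTree

/-- The positions of all vertices of a forest. -/
def forestPoints : List PointTree → Finset (ℕ × ℕ)
  | [] => ∅
  | t :: F => t.points ∪ forestPoints F

/-- The labels of the leaves of a forest. -/
def forestLeaves : List PointTree → Finset (ℕ × ℕ)
  | [] => ∅
  | t :: F => t.leaves ∪ forestLeaves F

/-- The condition that the vertices of a list of trees form a non-ambiguous forest, with the trees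
listed by the columns of their roots. -/
def ForestValid : List PointTree → Prop
  | [] => True
  | t :: F => t.Valid ∧ ForestValid F ∧ Apart t.points (forestPoints F) ∧
      ∀ s ∈ F, t.corner.1 < s.corner.1

theorem mem_forestPoints {F : List PointTree} {p : ℕ × ℕ} :
    p ∈ forestPoints F ↔ ∃ t ∈ F, p ∈ t.points := by
  induction F <;> simp_all [forestPoints]

theorem mem_forestLeaves {F : List PointTree} {p : ℕ × ℕ} :
    p ∈ forestLeaves F ↔ ∃ t ∈ F, p ∈ t.leaves := by
  induction F <;> simp_all [forestLeaves]

theorem forestLeaves_subset (F : List PointTree) : forestLeaves F ⊆ forestPoints F := by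
  intro p
  rw [mem_forestLeaves, mem_forestPoints]
  rintro ⟨t, ht, hp⟩
  exact ⟨t, ht, t.leaves_subset hp⟩

namespace ForestValid

theorem notBoth {F : List PointTree} (h : ForestValid F) : NotBoth (forestPoints F) := by
  induction F with
  | nil => simp [NotBoth, forestPoints]
  | cons t F ih => exact h.2.2.1.notBoth h.1.notBoth (ih h.2.1)

theorem hasLeaves {F : List PointTree} (h : ForestValid F) :
    HasLeaves (forestPoints F) (forestLeaves F) := by
  induction F with
  | nil => simp [HasLeaves, forestPoints, forestLeaves]
  | cons t F ih => exact h.2.2.1.hasLeaves h.1.hasLeaves (ih h.2.1)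

theorem isRoot_iff {F : List PointTree} (h : ForestValid F) (w : ℕ × ℕ) :
    IsRoot (forestPoints F) w ↔ ∃ t ∈ F, w = t.corner := by
  induction F with
  | nil => simp [IsRoot, forestPoints]
  | cons t F ih =>
    rw [List.exists_mem_cons_iff, ← h.1.isRoot_iff, ← ih h.2.1]
    have ha := h.2.2.1
    constructor
    · intro hw
      rcases Finset.mem_union.1 hw.1 with hm | hm
      · exact Or.inl ((ha.isRoot_iff hm).1 hw)
      · rw [forestPoints, Finset.union_comm] at hw
        exact Or.inr ((ha.symm.isRoot_iff hm).1 hw)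
    · rintro (hw | hw)
      · exact (ha.isRoot_iff hw.1).2 hw
      · rw [forestPoints, Finset.union_comm]
        exact (ha.symm.isRoot_iff hw.1).2 hw

theorem exists_isDescendant {F : List PointTree} (h : ForestValid F) {u : ℕ × ℕ}
    (hu : u ∈ forestPoints F) : ∃ t ∈ F, IsDescendant (forestPoints F) t.corner u := by
  induction F with
  | nil => simp [forestPoints] at hu
  | cons t F ih =>
    have ha := h.2.2.1
    rcases Finset.mem_union.1 hu with hm | hm
    · exact ⟨t, List.mem_cons_self,
        (ha.isDescendant_iff t.corner_mem u).2 ((h.1.isDescendant_corner u).2 hm)⟩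
    · obtain ⟨s, hs, hd⟩ := ih h.2.1 hm
      refine ⟨s, List.mem_cons_of_mem _ hs, ?_⟩
      rw [forestPoints, Finset.union_comm]
      exact (ha.symm.isDescendant_iff (mem_forestPoints.2 ⟨s, hs, s.corner_mem⟩) u).2 hd

/-- The analogue of `PointTree.Valid.belowWithin_node` for forests: the head tree has the first root
column, so all its points precede those of the other trees. -/
theorem leafBelow_cons {t : PointTree} {F : List PointTree} (h : ForestValid (t :: F))
    (u v : ℕ × ℕ) : LeafBelow (forestPoints (t :: F)) u v ↔
      BelowWithin True t.points u v ∨ LeafBelow (forestPoints F) u v ∨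
        (u ∈ t.points ∧ v ∈ forestPoints F) := by
  have ha := h.2.2.1
  have dt : ∀ u, IsDescendant (forestPoints (t :: F)) t.corner u ↔ u ∈ t.points := fun u =>
    (ha.isDescendant_iff t.corner_mem u).trans (h.1.isDescendant_corner u)
  have dF : ∀ s ∈ F, ∀ u, IsDescendant (forestPoints (t :: F)) s.corner u ↔
      IsDescendant (forestPoints F) s.corner u := by
    intro s hs u
    rw [forestPoints, Finset.union_comm]
    exact ha.symm.isDescendant_iff (mem_forestPoints.2 ⟨s, hs, s.corner_mem⟩) u
  have mF : ∀ s ∈ F, ∀ u, IsDescendant (forestPoints F) s.corner u → u ∈ forestPoints F :=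
    fun s hs u hd => hd.mem (mem_forestPoints.2 ⟨s, hs, s.corner_mem⟩)
  rw [leafBelow_iff, leafBelow_iff, forestPoints, ha.belowWithin_union, ← forestPoints]
  have key : (∃ r r', IsRoot (forestPoints (t :: F)) r ∧ IsRoot (forestPoints (t :: F)) r' ∧
      IsDescendant (forestPoints (t :: F)) r u ∧ IsDescendant (forestPoints (t :: F)) r' v ∧
      r.1 < r'.1) ↔ (∃ r r', IsRoot (forestPoints F) r ∧ IsRoot (forestPoints F) r' ∧
      IsDescendant (forestPoints F) r u ∧ IsDescendant (forestPoints F) r' v ∧ r.1 < r'.1) ∨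
      (u ∈ t.points ∧ v ∈ forestPoints F) := by
    simp only [h.isRoot_iff, h.2.1.isRoot_iff]
    constructor
    · rintro ⟨_, _, ⟨s, hs, rfl⟩, ⟨s', hs', rfl⟩, hu, hv, hlt⟩
      rcases List.mem_cons.1 hs with rfl | hs <;> rcases List.mem_cons.1 hs' with rfl | hs'
      · exact absurd hlt (lt_irrefl _)
      · exact Or.inr ⟨(dt _).1 hu, mF _ hs' _ ((dF _ hs' _).1 hv)⟩
      · exact absurd hlt (h.2.2.2 _ ‹_›).not_gt
      · exact Or.inl ⟨_, _, ⟨s, hs, rfl⟩, ⟨s', hs', rfl⟩, (dF _ hs _).1 hu, (dF _ hs' _).1 hv, hlt⟩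
    · rintro (⟨_, _, ⟨s, hs, rfl⟩, ⟨s', hs', rfl⟩, hu, hv, hlt⟩ | ⟨hu, hv⟩)
      · exact ⟨_, _, ⟨s, List.mem_cons_of_mem _ hs, rfl⟩, ⟨s', List.mem_cons_of_mem _ hs', rfl⟩,
          (dF _ hs _).2 hu, (dF _ hs' _).2 hv, hlt⟩
      · obtain ⟨s, hs, hd⟩ := h.2.1.exists_isDescendant hv
        exact ⟨_, _, ⟨t, List.mem_cons_self, rfl⟩, ⟨s, List.mem_cons_of_mem _ hs, rfl⟩,
          (dt _).2 hu, (dF _ hs _).2 hd, h.2.2.2 _ hs⟩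
  rw [key]
  exact (by tauto : ∀ a b c d : Prop, (a ∨ b) ∨ c ∨ d ↔ c ∨ (a ∨ d) ∨ b) _ _ _ _

end ForestValid

/-! ### Decomposing a non-ambiguous forest into trees -/

theorem IsParent.sum_lt {A : Finset (ℕ × ℕ)} {w c : ℕ × ℕ} (h : IsParent A w c) :
    w.1 + w.2 < c.1 + c.2 := by
  rcases h with ⟨-, -, h1, h2, -⟩ | ⟨-, -, h1, h2, -⟩ <;> omega

theorem IsDescendant.sum_le {A : Finset (ℕ × ℕ)} {w c : ℕ × ℕ} (h : IsDescendant A w c) :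
    w.1 + w.2 ≤ c.1 + c.2 := by
  induction h with
  | refl => exact le_rfl
  | tail _ h ih => exact ih.trans h.sum_lt.le

theorem isDescendant_of_column {A : Finset (ℕ × ℕ)} {p q : ℕ × ℕ} (hp : p ∈ A) (hq : q ∈ A)
    (h1 : p.1 = q.1) (h2 : p.2 ≤ q.2) : IsDescendant A p q := by
  induction hk : q.2 using Nat.strong_induction_on generalizing q with
  | _ k ih =>
    subst hk
    rcases h2.lt_or_eq with hlt | heq
    -- The nearest point before `q` in its column is a parent of `q`, and it is not before `p`.
    · obtain ⟨r, hr, hmax⟩ := Finset.exists_max_image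
        (A.filter fun r => r.1 = q.1 ∧ r.2 < q.2) (fun r => r.2) ⟨p, by simp [*]⟩
      simp only [Finset.mem_filter] at hr hmax
      exact (ih r.2 hr.2.2 hr.1 (h1.trans hr.2.1.symm) (hmax p ⟨hp, h1, hlt⟩) rfl).tail
        (Or.inl ⟨hr.1, hq, hr.2.1, hr.2.2, fun s hs e h => hmax s ⟨hs, e, h⟩⟩)
    · rw [Prod.ext h1 heq]
      exact Relation.ReflTransGen.refl

theorem isDescendant_of_row {A : Finset (ℕ × ℕ)} {p q : ℕ × ℕ} (hp : p ∈ A) (hq : q ∈ A)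
    (h1 : p.2 = q.2) (h2 : p.1 ≤ q.1) : IsDescendant A p q := by
  induction hk : q.1 using Nat.strong_induction_on generalizing q with
  | _ k ih =>
    subst hk
    rcases h2.lt_or_eq with hlt | heq
    · obtain ⟨r, hr, hmax⟩ := Finset.exists_max_image
        (A.filter fun r => r.2 = q.2 ∧ r.1 < q.1) (fun r => r.1) ⟨p, by simp [*]⟩
      simp only [Finset.mem_filter] at hr hmax
      exact (ih r.1 hr.2.2 hr.1 (h1.trans hr.2.1.symm) (hmax p ⟨hp, h1, hlt⟩) rfl).tail
        (Or.inr ⟨hr.1, hq, hr.2.1, hr.2.2, fun s hs e h => hmax s ⟨hs, e, h⟩⟩)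
    · rw [Prod.ext heq h1]
      exact Relation.ReflTransGen.refl

/-- Condition (1) excludes parents of different kinds, and the nearest predecessor in a column or
row is unique. -/
theorem NotBoth.parent_unique {A : Finset (ℕ × ℕ)} (hA : NotBoth A) {w w' c : ℕ × ℕ}
    (h : IsParent A w c) (h' : IsParent A w' c) : w = w' := by
  rcases h with h | h <;> rcases h' with h' | h'
  · have := h.2.2.2.2 _ h'.1 h'.2.2.1 h'.2.2.2.1
    have := h'.2.2.2.2 _ h.1 h.2.2.1 h.2.2.2.1
    exact Prod.ext (h.2.2.1.trans h'.2.2.1.symm) (by omega)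
  · exact absurd ⟨⟨w, h.1, h.2.2.1, h.2.2.2.1⟩, ⟨w', h'.1, h'.2.2.1, h'.2.2.2.1⟩⟩ (hA c h.2.1)
  · exact absurd ⟨⟨w', h'.1, h'.2.2.1, h'.2.2.2.1⟩, ⟨w, h.1, h.2.2.1, h.2.2.2.1⟩⟩ (hA c h.2.1)
  · have := h.2.2.2.2 _ h'.1 h'.2.2.1 h'.2.2.2.1
    have := h'.2.2.2.2 _ h.1 h.2.2.1 h.2.2.2.1
    exact Prod.ext (by omega) (h.2.2.1.trans h'.2.2.1.symm)

/-- Since parents are unique, the ancestors of `u` form a chain. -/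
theorem NotBoth.isDescendant_or {A : Finset (ℕ × ℕ)} (hA : NotBoth A) {c d u : ℕ × ℕ}
    (h : IsDescendant A c u) (h' : IsDescendant A d u) :
    IsDescendant A c d ∨ IsDescendant A d c := by
  induction h with
  | refl => exact Or.inr h'
  | @tail b u hb hbu ih =>
    rcases Relation.ReflTransGen.cases_tail h' with rfl | ⟨p, hp, hpu⟩
    · exact Or.inl (hb.tail hbu)
    · rw [hA.parent_unique hpu hbu] at hp
      exact ih hp

/-- Subtrees without common vertices share neither rows nor columns. -/
theorem apart_of_disjoint {A B C : Finset (ℕ × ℕ)} (hBA : B ⊆ A) (hCA : C ⊆ A)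
    (hB : ∀ p ∈ B, ∀ u, IsDescendant A p u → u ∈ B)
    (hC : ∀ p ∈ C, ∀ u, IsDescendant A p u → u ∈ C) (h : ∀ u ∈ B, u ∉ C) : Apart B C := by
  intro p hp q hq
  constructor
  · intro e
    rcases le_total p.2 q.2 with h1 | h1
    · exact h q (hB p hp q (isDescendant_of_column (hBA hp) (hCA hq) e h1)) hq
    · exact h p hp (hC q hq p (isDescendant_of_column (hCA hq) (hBA hp) e.symm h1))
  · intro e
    rcases le_total p.1 q.1 with h1 | h1
    · exact h q (hB p hp q (isDescendant_of_row (hBA hp) (hCA hq) e h1)) hq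
    · exact h p hp (hC q hq p (isDescendant_of_row (hCA hq) (hBA hp) e.symm h1))

/-- The subtrees of the two children of `w` are disjoint, because parents are unique, and hence
share no row or column. The corner formula recovers `w`, which shares its column with its left child
and its row with its right child. -/
theorem NotBoth.exists_tree {A : Finset (ℕ × ℕ)} (hA : NotBoth A)
    (hc : ∀ w ∈ A, (childrenIn A w).card = 0 ∨ (childrenIn A w).card = 2) {w : ℕ × ℕ}
    (hw : w ∈ A) :
    ∃ t : PointTree, t.Valid ∧ t.corner = w ∧ ∀ u, u ∈ t.points ↔ IsDescendant A w u := by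
  -- A child has a larger coordinate sum than its parent, so the distance of the sum from a bound
  -- `N` decreases towards the leaves.
  obtain ⟨N, hN⟩ : ∃ N, ∀ p ∈ A, p.1 + p.2 ≤ N :=
    ⟨A.sup fun p => p.1 + p.2, fun p hp => Finset.le_sup (f := fun p : ℕ × ℕ => p.1 + p.2) hp⟩
  induction hk : N - (w.1 + w.2) using Nat.strong_induction_on generalizing w with
  | _ k ih =>
    subst hk
    rcases hc w hw with h0 | h2
    · refine ⟨leaf w, trivial, rfl, fun u => ?_⟩
      rw [points, Finset.mem_singleton]
      constructor
      · rintro rfl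
        exact Relation.ReflTransGen.refl
      · intro hu
        rcases Relation.ReflTransGen.cases_head hu with rfl | ⟨c, hc', -⟩
        · rfl
        · rw [Finset.card_eq_zero] at h0
          exact absurd (mem_childrenIn.2 hc') (by simp [h0])
    · obtain ⟨⟨c, hcl⟩, ⟨d, hdr⟩⟩ := card_childrenIn_eq_two_iff.1 h2
      have hcp : IsParent A w c := Or.inl hcl
      have hdp : IsParent A w d := Or.inr hdr
      have hcs := hcp.sum_lt
      have hds := hdp.sum_lt
      have hcN := hN c hcl.2.1
      have hdN := hN d hdr.2.1
      obtain ⟨l, hl, lc, lp⟩ := ih _ (by omega) hcl.2.1 rfl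
      obtain ⟨r, hr, rc, rp⟩ := ih _ (by omega) hdr.2.1 rfl
      -- If `d` were a proper descendant of its sibling `c`, its parent `w` would be a descendant of
      -- `c`, against the growth of coordinate sums.
      have sib : ∀ {c d}, IsParent A w c → IsParent A w d → IsDescendant A c d → c = d := by
        intro c d hc hd h
        rcases Relation.ReflTransGen.cases_tail h with h | ⟨p, hp, hpd⟩
        · exact h.symm
        · rw [hA.parent_unique hpd hd] at hp
          have h1 : c.1 + c.2 ≤ w.1 + w.2 := IsDescendant.sum_le hp
          have h2 := hc.sum_lt
          omega
      have hne : c ≠ d := by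
        rintro rfl
        have := hcl.2.2.1
        have := hdr.2.2.2.1
        omega
      have cw := hcl.2.2.1
      have cw' := hcl.2.2.2.1
      have dw := hdr.2.2.1
      have dw' := hdr.2.2.2.1
      refine ⟨node l r, ⟨hl, hr, ?_, ?_, ?_⟩, ?_, fun u => ?_⟩
      · rw [lc, rc]
        omega
      · rw [lc, rc]
        omega
      · refine apart_of_disjoint (A := A) (fun u hu => ((lp u).1 hu).mem hcl.2.1)
          (fun u hu => ((rp u).1 hu).mem hdr.2.1)
          (fun p hp u hu => (lp u).2 (((lp p).1 hp).trans hu))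
          (fun p hp u hu => (rp u).2 (((rp p).1 hp).trans hu)) fun u hu hu' => ?_
        rcases hA.isDescendant_or ((lp u).1 hu) ((rp u).1 hu') with h | h
        · exact hne (sib hcp hdp h)
        · exact hne (sib hdp hcp h).symm
      · exact Prod.ext (by simp [corner, lc, cw]) (by simp [corner, rc, dw])
      · have e : (l.corner.1, r.corner.2) = w := Prod.ext (by simp [lc, cw]) (by simp [rc, dw])
        rw [mem_points_node, lp, rp, e]
        constructor
        · rintro (rfl | h | h)
          · exact Relation.ReflTransGen.refl
          · exact Relation.ReflTransGen.head hcp h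
          · exact Relation.ReflTransGen.head hdp h
        · intro h
          rcases Relation.ReflTransGen.cases_head h with rfl | ⟨x, hx, hxu⟩
          · exact Or.inl rfl
          · rcases hx with hx | hx
            · rw [hx.unique hcl] at hxu
              exact Or.inr (Or.inl hxu)
            · rw [hx.unique hdr] at hxu
              exact Or.inr (Or.inr hxu)

theorem exists_root {A : Finset (ℕ × ℕ)} {u : ℕ × ℕ} (hu : u ∈ A) :
    ∃ r, IsRoot A r ∧ IsDescendant A r u := by
  induction hk : u.1 + u.2 using Nat.strong_induction_on generalizing u with
  | _ k ih =>
    subst hk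
    by_cases h : ∃ p, IsParent A p u
    · obtain ⟨p, hp⟩ := h
      obtain ⟨r, hr, hd⟩ := ih _ hp.sum_lt hp.mem_left rfl
      exact ⟨r, hr, hd.tail hp⟩
    · exact ⟨u, ⟨hu, not_exists.1 h⟩, Relation.ReflTransGen.refl⟩

theorem IsRoot.eq_of_isDescendant {A : Finset (ℕ × ℕ)} {r w : ℕ × ℕ} (hr : IsRoot A r)
    (h : IsDescendant A w r) : w = r := by
  rcases Relation.ReflTransGen.cases_tail h with h | ⟨p, -, hp⟩
  · exact h.symm
  · exact absurd hp (hr.2 p)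

theorem IsCompleteNonAmbiguousForest.exists_forest {A : Finset (ℕ × ℕ)}
    (hA : IsCompleteNonAmbiguousForest A) : ∃ F, ForestValid F ∧ forestPoints F = A := by
  classical
  have hn : NotBoth A := hA.not_both
  suffices hs : ∀ S : Finset (ℕ × ℕ), (∀ r ∈ S, IsRoot A r) →
      ∃ F, ForestValid F ∧ (∀ t ∈ F, t.corner ∈ S) ∧
        ∀ u, u ∈ forestPoints F ↔ ∃ r ∈ S, IsDescendant A r u by
    obtain ⟨F, hF, -, hp⟩ := hs (A.filter fun r => IsRoot A r) (by simp)
    refine ⟨F, hF, Finset.ext fun u => ?_⟩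
    rw [hp]
    constructor
    · rintro ⟨r, hr, hd⟩
      exact hd.mem (Finset.mem_filter.1 hr).1
    · intro hu
      obtain ⟨r, hr, hd⟩ := exists_root hu
      exact ⟨r, Finset.mem_filter.2 ⟨hr.1, hr⟩, hd⟩
  -- Roots are inserted by decreasing column, so that each new tree goes to the front of the list.
  intro S
  induction S using Finset.induction_on_min_value (fun p : ℕ × ℕ => p.1) with
  | empty => exact fun _ => ⟨[], trivial, by simp, by simp [forestPoints]⟩
  | insert a S ha hmin ih =>
    intro hS
    have har := hS a (Finset.mem_insert_self _ _)
    obtain ⟨F, hF, hFc, hFp⟩ := ih fun r hr => hS r (Finset.mem_insert_of_mem hr)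
    obtain ⟨t, ht, htc, htp⟩ := hn.exists_tree hA.complete har.1
    refine ⟨t :: F, ⟨ht, hF, ?_, fun s hs => ?_⟩, fun s hs => ?_, fun u => ?_⟩
    · refine apart_of_disjoint (A := A) (fun u hu => ((htp u).1 hu).mem har.1)
          (fun u hu => ?_) (fun p hp u hu => (htp u).2 (((htp p).1 hp).trans hu))
          (fun p hp u hu => ?_) fun u hu hu' => ?_
      · obtain ⟨r, hr, hd⟩ := (hFp u).1 hu
        exact hd.mem (hS r (Finset.mem_insert_of_mem hr)).1
      · obtain ⟨r, hr, hd⟩ := (hFp p).1 hp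
        exact (hFp u).2 ⟨r, hr, hd.trans hu⟩
      · obtain ⟨r, hr, hd⟩ := (hFp u).1 hu'
        have hrr := hS r (Finset.mem_insert_of_mem hr)
        rcases hn.isDescendant_or ((htp u).1 hu) hd with h | h
        · exact ha (hrr.eq_of_isDescendant h ▸ hr)
        · exact ha (har.eq_of_isDescendant h ▸ hr)
    · have hsS := hFc s hs
      rw [htc]
      -- Two roots in one column would be an ancestor and its descendant.
      refine lt_of_le_of_ne (hmin _ hsS) fun e => ?_
      have hsr := hS _ (Finset.mem_insert_of_mem hsS)
      rcases le_total a.2 s.corner.2 with h | h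
      · have := hsr.eq_of_isDescendant (isDescendant_of_column har.1 hsr.1 e h)
        exact ha (this ▸ hsS)
      · have := har.eq_of_isDescendant (isDescendant_of_column hsr.1 har.1 e.symm h)
        exact ha (this ▸ hsS)
    · rcases List.mem_cons.1 hs with rfl | hs
      · rw [htc]
        exact Finset.mem_insert_self _ _
      · exact Finset.mem_insert_of_mem (hFc s hs)
    · simp only [forestPoints, Finset.mem_union, htp, hFp, Finset.mem_insert, exists_eq_or_imp]

/-! ### The order of the leaves is a strict total order -/

/-- An ordinal sum of two ranked relations, with `B` below `C`, is ranked. Both the trees and the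
forests obtain their order by iterating such sums, which shows that it is acyclic. -/
theorem exists_rank_union {α : Type*} {X Y : α → α → Prop} {B C : Finset α}
    (hBC : ∀ u ∈ B, u ∉ C) (hX : ∃ ρ : α → ℕ, ∀ u v, X u v → ρ u < ρ v)
    (hY : ∃ ρ : α → ℕ, ∀ u v, Y u v → ρ u < ρ v)
    (hB : ∀ u v, X u v → u ∈ B ∧ v ∈ B) (hC : ∀ u v, Y u v → u ∈ C ∧ v ∈ C) :
    ∃ ρ : α → ℕ, ∀ u v, X u v ∨ Y u v ∨ (u ∈ B ∧ v ∈ C) → ρ u < ρ v := by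
  classical
  obtain ⟨ρ, hρ⟩ := hX
  obtain ⟨τ, hτ⟩ := hY
  -- The shift by `B.sup ρ + 1` puts everything outside `B` above all ranks in `B`.
  refine ⟨fun u => if u ∈ B then ρ u else B.sup ρ + 1 + τ u, fun u v => ?_⟩
  have hC' : ∀ u ∈ C, u ∉ B := fun u hu hu' => hBC u hu' hu
  rintro (h | h | ⟨hu, hv⟩)
  · simp only [(hB u v h).1, (hB u v h).2, if_true]
    exact hρ u v h
  · simp only [hC' u (hC u v h).1, hC' v (hC u v h).2, if_false]
    exact Nat.add_lt_add_left (hτ u v h) _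
  · simp only [hu, hC' v hv, if_true, if_false]
    have := Finset.le_sup (f := ρ) hu
    omega

namespace PointTree

variable {l r : PointTree}

theorem Valid.belowWithin_node_true (h : (node l r).Valid) (u v : ℕ × ℕ) :
    BelowWithin True (node l r).points u v ↔ BelowWithin False r.points u v ∨
      BelowWithin True l.points u v ∨ (u ∈ r.points ∧ v ∈ l.points) := by
  rw [h.belowWithin_node]
  tauto

theorem Valid.belowWithin_node_false (h : (node l r).Valid) (u v : ℕ × ℕ) :
    BelowWithin False (node l r).points u v ↔ BelowWithin True l.points u v ∨
      BelowWithin False r.points u v ∨ (u ∈ l.points ∧ v ∈ r.points) := by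
  rw [h.belowWithin_node]
  tauto

theorem Valid.exists_rank {t : PointTree} (h : t.Valid) (b : Prop) :
    ∃ ρ : ℕ × ℕ → ℕ, ∀ u v, BelowWithin b t.points u v → ρ u < ρ v := by
  induction t generalizing b with
  | leaf p => exact ⟨fun _ => 0, fun u v h => absurd h (not_belowWithin_leaf _ _ _ _)⟩
  | node l r ihl ihr =>
    by_cases hb : b
    · simp only [hb, h.belowWithin_node_true]
      exact exists_rank_union (fun u hu => h.2.2.2.2.symm.notMem hu) (ihr h.2.1 _) (ihl h.1 _)
        (fun _ _ => BelowWithin.mem) (fun _ _ => BelowWithin.mem)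
    · simp only [hb, h.belowWithin_node_false]
      exact exists_rank_union (fun u hu => h.2.2.2.2.notMem hu) (ihl h.1 _) (ihr h.2.1 _)
        (fun _ _ => BelowWithin.mem) (fun _ _ => BelowWithin.mem)

theorem Valid.belowWithin_or {t : PointTree} (h : t.Valid) (b : Prop) {u v : ℕ × ℕ}
    (hu : u ∈ t.leaves) (hv : v ∈ t.leaves) (hne : u ≠ v) :
    BelowWithin b t.points u v ∨ BelowWithin b t.points v u := by
  induction t generalizing b with
  | leaf p =>
    simp only [leaves, Finset.mem_singleton] at hu hv
    exact absurd (hu.trans hv.symm) hne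
  | node l r ihl ihr =>
    simp only [leaves, Finset.mem_union] at hu hv
    rw [h.belowWithin_node, h.belowWithin_node]
    have sl := fun u (h : u ∈ l.leaves) => l.leaves_subset h
    have sr := fun u (h : u ∈ r.leaves) => r.leaves_subset h
    rcases hu with hu | hu <;> rcases hv with hv | hv
    · rcases ihl h.1 True hu hv with h | h <;> tauto
    · have := sl u hu
      have := sr v hv
      tauto
    · have := sr u hu
      have := sl v hv
      tauto
    · rcases ihr h.2.1 False hu hv with h | h <;> tauto

end PointTree

theorem LeafBelow.mem {A : Finset (ℕ × ℕ)} {u v : ℕ × ℕ} (h : LeafBelow A u v) :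
    u ∈ A ∧ v ∈ A := by
  rcases (leafBelow_iff _ _ _).1 h with ⟨r, r', hr, hr', hu, hv, -⟩ | h
  · exact ⟨hu.mem hr.1, hv.mem hr'.1⟩
  · exact h.mem

theorem not_leafBelow_empty (u v : ℕ × ℕ) : ¬ LeafBelow ∅ u v := fun h => by
  simpa using h.mem.1

namespace ForestValid

theorem exists_rank {F : List PointTree} (h : ForestValid F) :
    ∃ ρ : ℕ × ℕ → ℕ, ∀ u v, LeafBelow (forestPoints F) u v → ρ u < ρ v := by
  induction F with
  | nil => exact ⟨fun _ => 0, fun u v h => absurd h (not_leafBelow_empty _ _)⟩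
  | cons t F ih =>
    simp only [h.leafBelow_cons]
    exact exists_rank_union (fun u hu => h.2.2.1.notMem hu) (h.1.exists_rank _) (ih h.2.1)
        (fun _ _ => BelowWithin.mem) (fun _ _ => LeafBelow.mem)

theorem leafBelow_or {F : List PointTree} (h : ForestValid F) {u v : ℕ × ℕ}
    (hu : u ∈ forestLeaves F) (hv : v ∈ forestLeaves F) (hne : u ≠ v) :
    LeafBelow (forestPoints F) u v ∨ LeafBelow (forestPoints F) v u := by
  induction F with
  | nil => simp [forestLeaves] at hu
  | cons t F ih =>
    simp only [forestLeaves, Finset.mem_union] at hu hv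
    rw [h.leafBelow_cons, h.leafBelow_cons]
    have st := fun u (h : u ∈ t.leaves) => t.leaves_subset h
    have sF := fun u (h : u ∈ forestLeaves F) => forestLeaves_subset F h
    rcases hu with hu | hu <;> rcases hv with hv | hv
    · rcases h.1.belowWithin_or True hu hv hne with h | h <;> tauto
    · have := st u hu
      have := sF v hv
      tauto
    · have := sF u hu
      have := st v hv
      tauto
    · rcases ih h.2.1 hu hv with h | h <;> tauto

end ForestValid

/-! ### Pyramids -/

/-- `v` can be reached from `u` by going up along `R` inside `S`. -/
def Reach {α : Type*} (R : α → α → Prop) (S : Finset α) : α → α → Prop :=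
  Relation.ReflTransGen fun u v => R u v ∧ u ∈ S ∧ v ∈ S

section Reach

variable {α : Type*} {R : α → α → Prop} {S T : Finset α}

theorem Reach.mono (hST : S ⊆ T) {u v : α} (h : Reach R S u v) : Reach R T u v :=
  Relation.ReflTransGen.mono (fun _ _ h => ⟨h.1, hST h.2.1, hST h.2.2⟩) _ _ h

theorem Reach.mem_of_closed (hT : ∀ x ∈ S, ∀ y ∈ T, R x y → x ∈ T) {u v : α}
    (h : Reach R S u v) (hv : v ∈ T) : u ∈ T := by
  induction h using Relation.ReflTransGen.head_induction_on with
  | refl => exact hv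
  | head h1 _ ih => exact hT _ h1.2.1 _ ih h1.1

theorem Reach.restrict (hT : ∀ x ∈ T, ∀ y ∈ S, R x y → y ∈ T) {u v : α} (h : Reach R S u v)
    (hu : u ∈ T) : Reach R T u v := by
  induction h using Relation.ReflTransGen.head_induction_on with
  | refl => exact Relation.ReflTransGen.refl
  | head h1 _ ih =>
    have := hT _ hu _ h1.2.2 h1.1
    exact Relation.ReflTransGen.head ⟨h1.1, hu, this⟩ (ih this)

/-- Every point of a chain ending in `f` itself reaches `f`, so the chain stays in the down-set of
`f`, which is therefore a pyramid in its own right. -/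
theorem Reach.restrict_filter {f : α} [DecidablePred fun u => Reach R S u f] {u : α}
    (h : Reach R S u f) : Reach R (S.filter fun u => Reach R S u f) u f := by
  induction h using Relation.ReflTransGen.head_induction_on with
  | refl => exact Relation.ReflTransGen.refl
  | head h1 h2 ih =>
    refine Relation.ReflTransGen.head ⟨h1.1, ?_, ?_⟩ ih
    · exact Finset.mem_filter.2 ⟨h1.2.1, Relation.ReflTransGen.head h1 h2⟩
    · exact Finset.mem_filter.2 ⟨h1.2.2, h2⟩

theorem Reach.antisymm (hac : ∀ u, ¬ Relation.TransGen R u u) {u v : α} (h : Reach R S u v)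
    (h' : Reach R S v u) : u = v := by
  have hr : ∀ {u v}, Reach R S u v → Relation.ReflTransGen R u v := fun h =>
    Relation.ReflTransGen.mono (fun _ _ h => h.1) _ _ h
  rcases Relation.reflTransGen_iff_eq_or_transGen.1 (hr h) with h1 | h1
  · exact h1.symm
  · exact absurd (Relation.TransGen.trans_left h1 (hr h')) (hac u)

end Reach

/-- Crossing elements of `S` are comparable. -/
def OrientsCrossing (R : ℕ × ℕ → ℕ × ℕ → Prop) (S : Finset (ℕ × ℕ)) : Prop :=
  ∀ u ∈ S, ∀ v ∈ S, u ≠ v → Crossing u v → R u v ∨ R v u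

/-- The order of the leaves of `t` extends `R`. -/
def Compatible (R : ℕ × ℕ → ℕ × ℕ → Prop) (b : Prop) (t : PointTree) : Prop :=
  ∀ u ∈ t.leaves, ∀ v ∈ t.leaves, R u v → BelowWithin b t.points u v

theorem OrientsCrossing.mono {R : ℕ × ℕ → ℕ × ℕ → Prop} {S T : Finset (ℕ × ℕ)}
    (h : OrientsCrossing R T) (hST : S ⊆ T) : OrientsCrossing R S :=
  fun u hu v hv => h u (hST hu) v (hST hv)

namespace PointTree

variable {l r : PointTree} {R : ℕ × ℕ → ℕ × ℕ → Prop} {b : Prop}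

theorem leaves_left_subset : l.leaves ⊆ (node l r).leaves := Finset.subset_union_left

theorem leaves_right_subset : r.leaves ⊆ (node l r).leaves := Finset.subset_union_right

theorem leaves_nonempty (t : PointTree) : t.leaves.Nonempty :=
  let ⟨q, hq, _⟩ := t.exists_leaf_corner_fst
  ⟨q, hq⟩

theorem Valid.apart_leaves (h : (node l r).Valid) : Apart l.leaves r.leaves :=
  fun p hp q hq => h.2.2.2.2 p (l.leaves_subset hp) q (r.leaves_subset hq)

theorem Valid.belowWithin_left (h : (node l r).Valid) {u v : ℕ × ℕ} (hu : u ∈ l.points)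
    (hv : v ∈ l.points) (hb : BelowWithin b (node l r).points u v) :
    BelowWithin True l.points u v := by
  have hu' := h.2.2.2.2.notMem hu
  have hv' := h.2.2.2.2.notMem hv
  rcases (h.belowWithin_node _ _ _).1 hb with hb | hb | hb | hb
  · exact hb
  · exact absurd hb.mem.1 hu'
  · exact absurd hb.2.2 hu'
  · exact absurd hb.2.2 hv'

theorem Valid.belowWithin_right (h : (node l r).Valid) {u v : ℕ × ℕ} (hu : u ∈ r.points)
    (hv : v ∈ r.points) (hb : BelowWithin b (node l r).points u v) :
    BelowWithin False r.points u v := by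
  have hu' := h.2.2.2.2.symm.notMem hu
  have hv' := h.2.2.2.2.symm.notMem hv
  rcases (h.belowWithin_node _ _ _).1 hb with hb | hb | hb | hb
  · exact absurd hb.mem.1 hu'
  · exact hb
  · exact absurd hb.2.1 hv'
  · exact absurd hb.2.1 hu'

theorem Valid.belowWithin_left_right (h : (node l r).Valid) {u v : ℕ × ℕ} (hu : u ∈ l.points)
    (hv : v ∈ r.points) (hb : BelowWithin b (node l r).points u v) : ¬ b := by
  have hu' := h.2.2.2.2.notMem hu
  have hv' := h.2.2.2.2.symm.notMem hv
  have hm := fun h' : BelowWithin True l.points u v => h'.mem.2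
  have hm' := fun h' : BelowWithin False r.points u v => h'.mem.1
  rw [h.belowWithin_node] at hb
  tauto

theorem Valid.belowWithin_right_left (h : (node l r).Valid) {u v : ℕ × ℕ} (hu : u ∈ r.points)
    (hv : v ∈ l.points) (hb : BelowWithin b (node l r).points u v) : b := by
  have hu' := h.2.2.2.2.symm.notMem hu
  have hv' := h.2.2.2.2.notMem hv
  have hm := fun h' : BelowWithin True l.points u v => h'.mem.1
  have hm' := fun h' : BelowWithin False r.points u v => h'.mem.2
  rw [h.belowWithin_node] at hb
  tauto

theorem Valid.compatible_left (h : (node l r).Valid) (hc : Compatible R b (node l r)) :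
    Compatible R True l := fun u hu v hv huv =>
  h.belowWithin_left (l.leaves_subset hu) (l.leaves_subset hv)
    (hc u (leaves_left_subset hu) v (leaves_left_subset hv) huv)

theorem Valid.compatible_right (h : (node l r).Valid) (hc : Compatible R b (node l r)) :
    Compatible R False r := fun u hu v hv huv =>
  h.belowWithin_right (r.leaves_subset hu) (r.leaves_subset hv)
    (hc u (leaves_right_subset hu) v (leaves_right_subset hv) huv)

theorem Valid.mem_left_of_fst (h : (node l r).Valid) {e : ℕ × ℕ} (he : e ∈ (node l r).leaves)
    (he1 : e.1 = l.corner.1) : e ∈ l.leaves := by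
  refine (Finset.mem_union.1 he).resolve_right fun h' => ?_
  exact (h.2.2.2.2 _ l.corner_mem e (r.leaves_subset h')).1 he1.symm

theorem Valid.mem_right_of_snd (h : (node l r).Valid) {f : ℕ × ℕ} (hf : f ∈ (node l r).leaves)
    (hf2 : f.2 = r.corner.2) : f ∈ r.leaves := by
  refine (Finset.mem_union.1 hf).resolve_left fun h' => ?_
  exact (h.2.2.2.2 f (l.leaves_subset h') _ r.corner_mem).2 hf2

/-- The leaves on the left and right borders of a node are crossing. -/
theorem Valid.crossing (h : (node l r).Valid) {e f : ℕ × ℕ} (he : e ∈ l.leaves)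
    (he1 : e.1 = l.corner.1) (hf : f ∈ r.leaves) (hf2 : f.2 = r.corner.2) : Crossing e f := by
  have h1 := h.1.corner_le (l.leaves_subset he)
  have h2 := h.2.1.corner_le (r.leaves_subset hf)
  have h3 := h.2.2.1
  have h4 := h.2.2.2.1
  exact ⟨fun h => by omega, fun h => by omega⟩

/-- The leaves of a tree form a pyramid. Its top is the leaf of smallest column if the root counts
as a left child, and the leaf of smallest row otherwise. -/
theorem Valid.reach {t : PointTree} (h : t.Valid) (hR : OrientsCrossing R t.leaves)
    (hc : Compatible R b t) :
    (b → ∀ e ∈ t.leaves, e.1 = t.corner.1 → ∀ u ∈ t.leaves, Reach R t.leaves u e) ∧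
    (¬ b → ∀ f ∈ t.leaves, f.2 = t.corner.2 → ∀ u ∈ t.leaves, Reach R t.leaves u f) := by
  induction t generalizing b with
  | leaf p =>
    simp only [leaves, Finset.mem_singleton]
    constructor <;> rintro - _ rfl - _ rfl <;> exact Relation.ReflTransGen.refl
  | node l r ihl ihr =>
    have hl := (ihl h.1 (hR.mono leaves_left_subset) (h.compatible_left hc)).1 trivial
    have hr := (ihr h.2.1 (hR.mono leaves_right_subset) (h.compatible_right hc)).2 not_false
    constructor
    · intro hb e he he1 u hu
      have hel := h.mem_left_of_fst he he1
      rcases Finset.mem_union.1 hu with hu | hu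
      · exact (hl e hel he1 u hu).mono leaves_left_subset
      -- From the right subtree, climb to its top `f`. As `e` and `f` are on the two borders they
      -- cross, and compatibility when `b` holds only allows `f` below `e`.
      · obtain ⟨f, hf, hf2⟩ := r.exists_leaf_corner_snd
        have hf' : f ∈ (node l r).leaves := leaves_right_subset hf
        refine ((hr f hf hf2 u hu).mono leaves_right_subset).tail ⟨?_, hf', he⟩
        refine (hR e he f hf' ?_ (h.crossing hel he1 hf hf2)).resolve_left fun hef => ?_
        · rintro rfl
          exact h.apart_leaves.notMem hel hf
        · exact h.belowWithin_left_right (l.leaves_subset hel) (r.leaves_subset hf)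
            (hc e he f hf' hef) hb
    · intro hb f hf hf2 u hu
      have hfr := h.mem_right_of_snd hf hf2
      rcases Finset.mem_union.1 hu with hu | hu
      · obtain ⟨e, he, he1⟩ := l.exists_leaf_corner_fst
        have he' : e ∈ (node l r).leaves := leaves_left_subset he
        refine ((hl e he he1 u hu).mono leaves_left_subset).tail ⟨?_, he', hf⟩
        refine (hR e he' f hf ?_ (h.crossing he he1 hfr hf2)).resolve_right fun hef => ?_
        · rintro rfl
          exact h.apart_leaves.notMem he hfr
        · exact hb (h.belowWithin_right_left (r.leaves_subset hfr) (l.leaves_subset he)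
            (hc f hf e he' hef))
      · exact (hr f hfr hf2 u hu).mono leaves_right_subset

/-! ### A labelled tree is determined by its heap -/

theorem Valid.corner_le_of_subset {s t : PointTree} (ht : t.Valid) (h : s.leaves ⊆ t.leaves) :
    t.corner.1 ≤ s.corner.1 ∧ t.corner.2 ≤ s.corner.2 := by
  obtain ⟨e, he, he1⟩ := s.exists_leaf_corner_fst
  obtain ⟨f, hf, hf2⟩ := s.exists_leaf_corner_snd
  rw [← he1, ← hf2]
  exact ⟨(ht.corner_le (t.leaves_subset (h he))).1, (ht.corner_le (t.leaves_subset (h hf))).2⟩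

/-- The coordinates of the corner are the smallest column and the smallest row among the leaves. -/
theorem Valid.corner_eq {s t : PointTree} (hs : s.Valid) (ht : t.Valid)
    (h : s.leaves = t.leaves) : s.corner = t.corner := by
  have h1 := ht.corner_le_of_subset h.subset
  have h2 := hs.corner_le_of_subset h.symm.subset
  exact Prod.ext (by omega) (by omega)

/-- All leaves of `r` reach the leaf `f` of smallest row, and `f` is also in `r'`. When `b` holds,
no leaf of `l'` is `R`-below a leaf of `r'`, so a chain ending in `r'` never leaves it. -/
theorem Valid.right_leaves_subset {l' r' : PointTree} (h : (node l r).Valid)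
    (h' : (node l' r').Valid) (hL : (node l r).leaves = (node l' r').leaves)
    (hR : OrientsCrossing R (node l r).leaves) (hc : Compatible R b (node l r))
    (hc' : Compatible R b (node l' r')) (hb : b) : r.leaves ⊆ r'.leaves := by
  intro u hu
  obtain ⟨f, hf, hf2⟩ := r.exists_leaf_corner_snd
  have hco : r.corner.2 = r'.corner.2 :=
    (Prod.ext_iff.1 (h.corner_eq h' hL)).2
  have hf' : f ∈ r'.leaves :=
    h'.mem_right_of_snd (hL ▸ leaves_right_subset hf) (hf2.trans hco)
  have hr := (h.2.1.reach (hR.mono leaves_right_subset) (h.compatible_right hc)).2 not_false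
    f hf hf2 u hu
  refine hr.mem_of_closed (fun x hx y hy hxy => ?_) hf'
  have hx' : x ∈ (node l' r').leaves := hL ▸ leaves_right_subset hx
  refine (Finset.mem_union.1 hx').resolve_left fun hxl => ?_
  exact h'.belowWithin_left_right (l'.leaves_subset hxl) (r'.leaves_subset hy)
    (hc' x hx' y (leaves_right_subset hy) hxy) hb

theorem Valid.left_leaves_subset {l' r' : PointTree} (h : (node l r).Valid)
    (h' : (node l' r').Valid) (hL : (node l r).leaves = (node l' r').leaves)
    (hR : OrientsCrossing R (node l r).leaves) (hc : Compatible R b (node l r))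
    (hc' : Compatible R b (node l' r')) (hb : ¬ b) : l.leaves ⊆ l'.leaves := by
  intro u hu
  obtain ⟨e, he, he1⟩ := l.exists_leaf_corner_fst
  have hco : l.corner.1 = l'.corner.1 :=
    (Prod.ext_iff.1 (h.corner_eq h' hL)).1
  have he' : e ∈ l'.leaves :=
    h'.mem_left_of_fst (hL ▸ leaves_left_subset he) (he1.trans hco)
  have hr := (h.1.reach (hR.mono leaves_left_subset) (h.compatible_left hc)).1 trivial
    e he he1 u hu
  refine hr.mem_of_closed (fun x hx y hy hxy => ?_) he'
  have hx' : x ∈ (node l' r').leaves := hL ▸ leaves_left_subset hx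
  refine (Finset.mem_union.1 hx').resolve_right fun hxr => ?_
  exact hb (h'.belowWithin_right_left (r'.leaves_subset hxr) (l'.leaves_subset hy)
    (hc' x hx' y (leaves_left_subset hy) hxy))

theorem Valid.leaf_ne_node {p : ℕ × ℕ} (h : (node l r).Valid) :
    (leaf p).leaves ≠ (node l r).leaves := by
  intro hL
  obtain ⟨u, hu⟩ := l.leaves_nonempty
  obtain ⟨v, hv⟩ := r.leaves_nonempty
  have hu' : u ∈ (leaf p).leaves := hL ▸ leaves_left_subset hu
  have hv' : v ∈ (leaf p).leaves := hL ▸ leaves_right_subset hv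
  simp only [leaves, Finset.mem_singleton] at hu' hv'
  exact h.apart_leaves.notMem hu (hu'.trans hv'.symm ▸ hv)

/-- One of the two leaf sets at the root is a down-set of the heap fixed by `R` and `b`, and the
other is its complement. Both trees split in the same way, and induction applies. -/
theorem Valid.eq_of_leaves_eq {t t' : PointTree} (h : t.Valid) (h' : t'.Valid)
    (hL : t.leaves = t'.leaves) (hR : OrientsCrossing R t.leaves) (hc : Compatible R b t)
    (hc' : Compatible R b t') : t = t' := by
  induction t generalizing t' b with
  | leaf p =>
    cases t' with
    | leaf q => simpa [leaves] using hL
    | node l' r' => exact absurd hL h'.leaf_ne_node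
  | node l r ihl ihr =>
    cases t' with
    | leaf q => exact absurd hL.symm h.leaf_ne_node
    | node l' r' =>
      have hR' : OrientsCrossing R (node l' r').leaves := hL ▸ hR
      have hmem : ∀ u, (u ∈ l.leaves ∨ u ∈ r.leaves) ↔ (u ∈ l'.leaves ∨ u ∈ r'.leaves) := by
        intro u
        rw [← Finset.mem_union, ← Finset.mem_union]
        exact Finset.ext_iff.1 hL u
      have ha := fun u => h.apart_leaves.notMem (p := u)
      have ha' := fun u => h'.apart_leaves.notMem (p := u)
      have key : l.leaves = l'.leaves ∧ r.leaves = r'.leaves := by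
        by_cases hb : b
        · have hr : r.leaves = r'.leaves :=
            (h.right_leaves_subset h' hL hR hc hc' hb).antisymm
              (h'.right_leaves_subset h hL.symm hR' hc' hc hb)
          refine ⟨Finset.ext fun u => ?_, hr⟩
          have := hmem u
          have := ha u
          have := ha' u
          rw [hr] at *
          tauto
        · have hl : l.leaves = l'.leaves :=
            (h.left_leaves_subset h' hL hR hc hc' hb).antisymm
              (h'.left_leaves_subset h hL.symm hR' hc' hc hb)
          refine ⟨hl, Finset.ext fun u => ?_⟩
          have := hmem u
          have := ha u
          have := ha' u
          rw [hl] at *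
          tauto
      rw [ihl h.1 h'.1 key.1 (hR.mono leaves_left_subset) (h.compatible_left hc)
          (h'.compatible_left hc'),
        ihr h.2.1 h'.2.1 key.2 (hR.mono leaves_right_subset) (h.compatible_right hc)
          (h'.compatible_right hc')]

end PointTree

/-! ### Forests determined by their heaps -/

theorem ForestValid.corner_fst_le {t : PointTree} {F : List PointTree}
    (h : ForestValid (t :: F)) {p : ℕ × ℕ} (hp : p ∈ forestPoints (t :: F)) :
    t.corner.1 ≤ p.1 := by
  rcases Finset.mem_union.1 hp with hp | hp
  · exact (h.1.corner_le hp).1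
  · obtain ⟨s, hs, hps⟩ := mem_forestPoints.1 hp
    have hv : ∀ {F}, ForestValid F → ∀ s ∈ F, s.Valid := by
      intro F
      induction F with
      | nil => simp
      | cons t F ih =>
        intro h s hs
        rcases List.mem_cons.1 hs with rfl | hs
        · exact h.1
        · exact ih h.2.1 s hs
    exact (h.2.2.2 s hs).le.trans ((hv h.2.1 s hs).corner_le hps).1

/-- The order of the leaves of the forest `F` extends `R`. -/
def ForestCompatible (R : ℕ × ℕ → ℕ × ℕ → Prop) (F : List PointTree) : Prop :=
  ∀ u ∈ forestLeaves F, ∀ v ∈ forestLeaves F, R u v → LeafBelow (forestPoints F) u v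

namespace ForestValid

variable {t t' : PointTree} {F F' : List PointTree} {R : ℕ × ℕ → ℕ × ℕ → Prop}

theorem compatible_head (h : ForestValid (t :: F)) (hc : ForestCompatible R (t :: F)) :
    Compatible R True t := by
  intro u hu v hv huv
  have hu' := h.2.2.1.notMem (t.leaves_subset hu)
  have hv' := h.2.2.1.notMem (t.leaves_subset hv)
  have hb := hc u (Finset.mem_union_left _ hu) v (Finset.mem_union_left _ hv) huv
  rcases (h.leafBelow_cons _ _).1 hb with hb | hb | hb
  · exact hb
  · exact absurd hb.mem.1 hu'
  · exact absurd hb.2 hv'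

theorem compatible_tail (h : ForestValid (t :: F)) (hc : ForestCompatible R (t :: F)) :
    ForestCompatible R F := by
  intro u hu v hv huv
  have hu' := h.2.2.1.symm.notMem (forestLeaves_subset F hu)
  have hv' := h.2.2.1.symm.notMem (forestLeaves_subset F hv)
  have hb := hc u (Finset.mem_union_right _ hu) v (Finset.mem_union_right _ hv) huv
  rcases (h.leafBelow_cons _ _).1 hb with hb | hb | hb
  · exact absurd hb.mem.1 hu'
  · exact hb
  · exact absurd hb.1 hu'

theorem head_corner_fst_le (h : ForestValid (t :: F))
    (hL : t'.leaves ⊆ forestLeaves (t :: F)) : t.corner.1 ≤ t'.corner.1 := by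
  obtain ⟨e, he, he1⟩ := t'.exists_leaf_corner_fst
  rw [← he1]
  exact h.corner_fst_le (forestLeaves_subset _ (hL he))

/-- The first tree is a pyramid whose top is the leaf of smallest column of the whole forest. This
leaf lies in the first tree of either forest, and no later tree has a leaf `R`-below one of the
first tree. -/
theorem head_leaves_subset (h : ForestValid (t :: F)) (h' : ForestValid (t' :: F'))
    (hL : forestLeaves (t :: F) = forestLeaves (t' :: F'))
    (hR : OrientsCrossing R (forestLeaves (t :: F))) (hc : ForestCompatible R (t :: F))
    (hc' : ForestCompatible R (t' :: F')) : t.leaves ⊆ t'.leaves := by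
  intro u hu
  obtain ⟨e, he, he1⟩ := t.exists_leaf_corner_fst
  have hco : t.corner.1 = t'.corner.1 := le_antisymm
    (h.head_corner_fst_le (hL ▸ Finset.subset_union_left))
    (h'.head_corner_fst_le (hL ▸ Finset.subset_union_left))
  have hsplit : ∀ {x}, x ∈ t.leaves → x ∈ t'.leaves ∨ x ∈ forestLeaves F' := by
    intro x hx
    have : x ∈ forestLeaves (t' :: F') := hL ▸ Finset.mem_union_left _ hx
    exact Finset.mem_union.1 this
  have he' : e ∈ t'.leaves := by
    refine (hsplit he).resolve_right fun h1 => ?_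
    exact (h'.2.2.1 _ t'.corner_mem e (forestLeaves_subset _ h1)).1 (hco.symm.trans he1.symm)
  have hr := (h.1.reach (hR.mono Finset.subset_union_left) (h.compatible_head hc)).1 trivial
    e he he1 u hu
  refine hr.mem_of_closed (fun x hx y hy hxy => ?_) he'
  refine (hsplit hx).resolve_right fun hxF => ?_
  have hb := hc' x (Finset.mem_union_right _ hxF) y (Finset.mem_union_left _ hy) hxy
  have hx' := h'.2.2.1.symm.notMem (forestLeaves_subset F' hxF)
  have hy' := h'.2.2.1.notMem (t'.leaves_subset hy)
  have hm := fun h' : BelowWithin True t'.points x y => h'.mem.1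
  have hm' := fun h' : LeafBelow (forestPoints F') x y => h'.mem.2
  rw [h'.leafBelow_cons] at hb
  tauto

/-- A forest of labelled trees is determined by its heap. -/
theorem eq_of_leaves_eq (h : ForestValid F) (h' : ForestValid F')
    (hL : forestLeaves F = forestLeaves F') (hR : OrientsCrossing R (forestLeaves F))
    (hc : ForestCompatible R F) (hc' : ForestCompatible R F') : F = F' := by
  induction F generalizing F' with
  | nil =>
    cases F' with
    | nil => rfl
    | cons t' F' =>
      obtain ⟨u, hu⟩ := t'.leaves_nonempty
      have : u ∈ forestLeaves [] := hL ▸ Finset.mem_union_left _ hu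
      simp [forestLeaves] at this
  | cons t F ih =>
    cases F' with
    | nil =>
      obtain ⟨u, hu⟩ := t.leaves_nonempty
      have : u ∈ forestLeaves [] := hL ▸ Finset.mem_union_left _ hu
      simp [forestLeaves] at this
    | cons t' F' =>
      have ht : t.leaves = t'.leaves := (h.head_leaves_subset h' hL hR hc hc').antisymm
        (h'.head_leaves_subset h hL.symm (hL ▸ hR) hc' hc)
      have hF : forestLeaves F = forestLeaves F' := by
        ext u
        have h1 := Finset.ext_iff.1 hL u
        have h2 : u ∈ t.leaves → u ∉ forestLeaves F := fun hu hu' =>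
          h.2.2.1.notMem (t.leaves_subset hu) (forestLeaves_subset F hu')
        have h3 : u ∈ t'.leaves → u ∉ forestLeaves F' := fun hu hu' =>
          h'.2.2.1.notMem (t'.leaves_subset hu) (forestLeaves_subset F' hu')
        simp only [forestLeaves, Finset.mem_union] at h1
        rw [ht] at *
        tauto
      rw [h.1.eq_of_leaves_eq h'.1 ht (hR.mono Finset.subset_union_left) (h.compatible_head hc)
          (h'.compatible_head hc'),
        ih h.2.1 h'.2.1 hF (hR.mono Finset.subset_union_right) (h.compatible_tail hc)
          (h'.compatible_tail hc')]

end ForestValid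

/-! ### Every heap comes from a forest -/

/-- The points of `S` lie in distinct columns and distinct rows. -/
def Generic (S : Finset (ℕ × ℕ)) : Prop :=
  ∀ u ∈ S, ∀ v ∈ S, u ≠ v → u.1 ≠ v.1 ∧ u.2 ≠ v.2

theorem Generic.mono {S T : Finset (ℕ × ℕ)} (h : Generic T) (hST : S ⊆ T) : Generic S :=
  fun u hu v hv => h u (hST hu) v (hST hv)

theorem Generic.apart {S B C : Finset (ℕ × ℕ)} (h : Generic S) (hB : B ⊆ S) (hC : C ⊆ S)
    (hBC : ∀ u ∈ B, u ∉ C) : Apart B C := by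
  refine fun p hp q hq => h p (hB hp) q (hC hq) ?_
  rintro rfl
  exact hBC p hp hq

section Existence

variable {R : ℕ × ℕ → ℕ × ℕ → Prop}

/-- A pyramid whose top element is smallest in both coordinates has only one element. -/
theorem eq_singleton_of_reach {S : Finset (ℕ × ℕ)} (hS : Generic S)
    (hcr : ∀ u v, R u v → Crossing u v) (hac : ∀ u, ¬ Relation.TransGen R u u) {e : ℕ × ℕ}
    (he : e ∈ S) (hr : ∀ u ∈ S, Reach R S u e) (h1 : ∀ u ∈ S, e.1 ≤ u.1)
    (h2 : ∀ u ∈ S, e.2 ≤ u.2) : S = {e} := by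
  refine Finset.eq_singleton_iff_unique_mem.2 ⟨he, fun u hu => ?_⟩
  -- The last link `v → e` would make `v` cross `e`, although `e` is strictly to the left of `v`.
  rcases Relation.ReflTransGen.cases_tail (hr u hu) with h | ⟨v, -, hve, hv, -⟩
  · exact h.symm
  · have hne : e ≠ v := by
      rintro rfl
      exact hac e (Relation.TransGen.single hve)
    have := hS e he v hv hne
    exact absurd ⟨lt_of_le_of_ne (h1 v hv) this.1, lt_of_le_of_ne (h2 v hv) this.2⟩
      (hcr _ _ hve).2

/-- Glueing the trees of the two parts of a pyramid. -/
theorem exists_node {S T : Finset (ℕ × ℕ)} (hS : Generic S) {b : Prop} {l r : PointTree}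
    (hl : l.Valid) (hr : r.Valid) (hlT : l.leaves = S \ T) (hrT : r.leaves = T) (hTS : T ⊆ S)
    {e f : ℕ × ℕ} (he : e ∈ l.leaves) (hf : f ∈ r.leaves) (he1 : ∀ u ∈ S, e.1 ≤ u.1)
    (hf2 : ∀ u ∈ S, f.2 ≤ u.2) (hcl : Compatible R True l) (hcr : Compatible R False r)
    (hlr : ∀ u ∈ l.leaves, ∀ v ∈ r.leaves, R u v → ¬ b)
    (hrl : ∀ u ∈ r.leaves, ∀ v ∈ l.leaves, R u v → b) :
    ∃ t : PointTree, t.Valid ∧ t.leaves = S ∧ Compatible R b t := by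
  have hlS : l.leaves ⊆ S := hlT ▸ Finset.sdiff_subset
  have hrS : r.leaves ⊆ S := hrT ▸ hTS
  have ha : Apart l.leaves r.leaves := hS.apart hlS hrS fun u hu hu' => by
    rw [hlT] at hu
    rw [hrT] at hu'
    exact (Finset.mem_sdiff.1 hu).2 hu'
  have hv : (node l r).Valid := by
    refine ⟨hl, hr, ?_, ?_, apart_points ha⟩
    -- The column of `l.corner` is at most that of `e`, which is the smallest column of `S` and is
    -- not used by `r`.
    · obtain ⟨q, hq, hq1⟩ := r.exists_leaf_corner_fst
      have h1 := (hl.corner_le (l.leaves_subset he)).1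
      have h2 := he1 q (hrS hq)
      have h3 := (ha e he q hq).1
      omega
    · obtain ⟨q, hq, hq2⟩ := l.exists_leaf_corner_snd
      have h1 := (hr.corner_le (r.leaves_subset hf)).2
      have h2 := hf2 q (hlS hq)
      have h3 := (ha q hq f hf).2
      omega
  refine ⟨node l r, hv, ?_, ?_⟩
  · rw [leaves, hlT, hrT, Finset.sdiff_union_of_subset hTS]
  · intro u hu v hv' huv
    rw [hv.belowWithin_node]
    rcases Finset.mem_union.1 hu with hu | hu <;> rcases Finset.mem_union.1 hv' with hv' | hv'
    · exact Or.inl (hcl u hu v hv' huv)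
    · exact Or.inr (Or.inr (Or.inr
        ⟨hlr u hu v hv' huv, l.leaves_subset hu, r.leaves_subset hv'⟩))
    · exact Or.inr (Or.inr (Or.inl
        ⟨hrl u hu v hv' huv, l.leaves_subset hv', r.leaves_subset hu⟩))
    · exact Or.inr (Or.inl (hcr u hu v hv' huv))

theorem exists_leaf {e : ℕ × ℕ} (b : Prop) (hac : ∀ u, ¬ Relation.TransGen R u u) :
    ∃ t : PointTree, t.Valid ∧ t.leaves = {e} ∧ Compatible R b t := by
  refine ⟨leaf e, trivial, rfl, fun u hu v hv huv => ?_⟩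
  simp only [leaves, Finset.mem_singleton] at hu hv
  subst hu hv
  exact absurd (Relation.TransGen.single huv) (hac _)

/-- Every pyramid whose top has smallest column, or smallest row, comes from a labelled tree. -/
theorem exists_tree_of_pyramid (hcr : ∀ u v, R u v → Crossing u v)
    (hac : ∀ u, ¬ Relation.TransGen R u u) (S : Finset (ℕ × ℕ)) (hS : Generic S) :
    ((∃ e ∈ S, (∀ u ∈ S, e.1 ≤ u.1) ∧ ∀ u ∈ S, Reach R S u e) →
      ∃ t : PointTree, t.Valid ∧ t.leaves = S ∧ Compatible R True t) ∧
    ((∃ f ∈ S, (∀ u ∈ S, f.2 ≤ u.2) ∧ ∀ u ∈ S, Reach R S u f) →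
      ∃ t : PointTree, t.Valid ∧ t.leaves = S ∧ Compatible R False t) := by
  classical
  induction S using Finset.strongInduction with
  | H S ih =>
    constructor
    · rintro ⟨e, he, he1, her⟩
      obtain ⟨f, hf, hf2⟩ := S.exists_min_image (fun u => u.2) ⟨e, he⟩
      by_cases hef : e = f
      · rw [eq_singleton_of_reach hS hcr hac he her he1 (hef ▸ hf2)]
        exact exists_leaf _ hac
      -- The right subtree must carry the down-set of `f`. It misses the top `e` by acyclicity. Its
      -- complement is an up-set, so chains from there to `e` stay in it. Both parts are smaller
      -- pyramids of the required kinds.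
      have hT : (S.filter fun u => Reach R S u f) ⊆ S := Finset.filter_subset _ _
      have hfT : f ∈ S.filter fun u => Reach R S u f :=
        Finset.mem_filter.2 ⟨hf, Relation.ReflTransGen.refl⟩
      have heT : e ∉ S.filter fun u => Reach R S u f := fun h =>
        hef (Reach.antisymm hac (Finset.mem_filter.1 h).2 (her f hf))
      have hrT : ∀ u ∈ S.filter (fun u => Reach R S u f),
          Reach R (S.filter fun u => Reach R S u f) u f :=
        fun u hu => (Finset.mem_filter.1 hu).2.restrict_filter
      have hdown : ∀ x ∈ S, ∀ y ∈ S.filter (fun u => Reach R S u f), R x y →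
          x ∈ S.filter fun u => Reach R S u f := fun x hx y hy hxy =>
        Finset.mem_filter.2 ⟨hx, Relation.ReflTransGen.head
          ⟨hxy, hx, (Finset.mem_filter.1 hy).1⟩ (Finset.mem_filter.1 hy).2⟩
      generalize (S.filter fun u => Reach R S u f) = T at *
      have heL : e ∈ S \ T := Finset.mem_sdiff.2 ⟨he, heT⟩
      have hLS : S \ T ⊆ S := Finset.sdiff_subset
      obtain ⟨r, hr, hrL, hrc⟩ := (ih T ⟨hT, fun h => heT (h he)⟩ (hS.mono hT)).2
        ⟨f, hfT, fun u hu => hf2 u (hT hu), hrT⟩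
      obtain ⟨l, hl, hlL, hlc⟩ := (ih (S \ T)
        ⟨hLS, fun h => (Finset.mem_sdiff.1 (h hf)).2 hfT⟩ (hS.mono hLS)).1
        ⟨e, heL, fun u hu => he1 u (hLS hu), fun u hu =>
          (her u (hLS hu)).restrict (fun x hx y hy hxy => Finset.mem_sdiff.2 ⟨hy, fun hyT =>
            (Finset.mem_sdiff.1 hx).2 (hdown x (hLS hx) y hyT hxy)⟩) hu⟩
      refine exists_node hS hl hr hlL hrL hT (hlL ▸ heL) (hrL ▸ hfT) he1 hf2 hlc hrc ?_
        (fun _ _ _ _ _ => trivial)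
      intro u hu v hv huv
      rw [hlL] at hu
      rw [hrL] at hv
      exact absurd (hdown u (hLS hu) v hv huv) (Finset.mem_sdiff.1 hu).2
    · rintro ⟨f, hf, hf2, hfr⟩
      obtain ⟨e, he, he1⟩ := S.exists_min_image (fun u => u.1) ⟨f, hf⟩
      by_cases hef : f = e
      · rw [eq_singleton_of_reach hS hcr hac hf hfr (hef ▸ he1) hf2]
        exact exists_leaf _ hac
      -- With the root counted as a right child the roles are exchanged: the left subtree carries
      -- the down-set of `e`, and its complement is passed to `exists_node` as the right part.
      have hT : (S.filter fun u => Reach R S u e) ⊆ S := Finset.filter_subset _ _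
      have heT : e ∈ S.filter fun u => Reach R S u e :=
        Finset.mem_filter.2 ⟨he, Relation.ReflTransGen.refl⟩
      have hfT : f ∉ S.filter fun u => Reach R S u e := fun h =>
        hef (Reach.antisymm hac (Finset.mem_filter.1 h).2 (hfr e he))
      have hrT : ∀ u ∈ S.filter (fun u => Reach R S u e),
          Reach R (S.filter fun u => Reach R S u e) u e :=
        fun u hu => (Finset.mem_filter.1 hu).2.restrict_filter
      have hdown : ∀ x ∈ S, ∀ y ∈ S.filter (fun u => Reach R S u e), R x y →
          x ∈ S.filter fun u => Reach R S u e := fun x hx y hy hxy =>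
        Finset.mem_filter.2 ⟨hx, Relation.ReflTransGen.head
          ⟨hxy, hx, (Finset.mem_filter.1 hy).1⟩ (Finset.mem_filter.1 hy).2⟩
      generalize (S.filter fun u => Reach R S u e) = T at *
      have hfL : f ∈ S \ T := Finset.mem_sdiff.2 ⟨hf, hfT⟩
      have hLS : S \ T ⊆ S := Finset.sdiff_subset
      obtain ⟨l, hl, hlL, hlc⟩ := (ih T ⟨hT, fun h => hfT (h hf)⟩ (hS.mono hT)).1
        ⟨e, heT, fun u hu => he1 u (hT hu), hrT⟩
      obtain ⟨r, hr, hrL, hrc⟩ := (ih (S \ T)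
        ⟨hLS, fun h => (Finset.mem_sdiff.1 (h he)).2 heT⟩ (hS.mono hLS)).2
        ⟨f, hfL, fun u hu => hf2 u (hLS hu), fun u hu =>
          (hfr u (hLS hu)).restrict (fun x hx y hy hxy => Finset.mem_sdiff.2 ⟨hy, fun hyT =>
            (Finset.mem_sdiff.1 hx).2 (hdown x (hLS hx) y hyT hxy)⟩) hu⟩
      refine exists_node hS hl hr (hlL.trans (Finset.sdiff_sdiff_eq_self hT).symm) hrL hLS
        (hlL ▸ heT) (hrL ▸ hfL) he1 hf2 hlc hrc (fun _ _ _ _ _ => not_false) ?_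
      intro u hu v hv huv
      rw [hrL] at hu
      rw [hlL] at hv
      exact absurd (hdown u (hLS hu) v hv huv) (Finset.mem_sdiff.1 hu).2

/-- Every heap comes from a forest of labelled trees. -/
theorem exists_forest_of_heap (hcr : ∀ u v, R u v → Crossing u v)
    (hac : ∀ u, ¬ Relation.TransGen R u u) (S : Finset (ℕ × ℕ)) (hS : Generic S) :
    ∃ F, ForestValid F ∧ forestLeaves F = S ∧ ForestCompatible R F := by
  classical
  induction S using Finset.strongInduction with
  | H S ih =>
    rcases S.eq_empty_or_nonempty with rfl | hne
    · exact ⟨[], trivial, rfl, fun u hu => by simp [forestLeaves] at hu⟩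
    obtain ⟨e, he, he1⟩ := S.exists_min_image (fun u => u.1) hne
    -- The first tree must carry the down-set of the leaf of smallest column. Nothing outside lies
    -- below it, so the remaining trees can be placed above.
    have hT : (S.filter fun u => Reach R S u e) ⊆ S := Finset.filter_subset _ _
    have heT : e ∈ S.filter fun u => Reach R S u e :=
      Finset.mem_filter.2 ⟨he, Relation.ReflTransGen.refl⟩
    have hrT : ∀ u ∈ S.filter (fun u => Reach R S u e),
        Reach R (S.filter fun u => Reach R S u e) u e :=
      fun u hu => (Finset.mem_filter.1 hu).2.restrict_filter
    have hdown : ∀ x ∈ S, ∀ y ∈ S.filter (fun u => Reach R S u e), R x y →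
        x ∈ S.filter fun u => Reach R S u e := fun x hx y hy hxy =>
      Finset.mem_filter.2 ⟨hx, Relation.ReflTransGen.head
        ⟨hxy, hx, (Finset.mem_filter.1 hy).1⟩ (Finset.mem_filter.1 hy).2⟩
    generalize (S.filter fun u => Reach R S u e) = T at *
    have hLS : S \ T ⊆ S := Finset.sdiff_subset
    obtain ⟨t, ht, htL, htc⟩ := (exists_tree_of_pyramid hcr hac T (hS.mono hT)).1
      ⟨e, heT, fun u hu => he1 u (hT hu), hrT⟩
    obtain ⟨F, hF, hFL, hFc⟩ := ih (S \ T)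
      ⟨hLS, fun h => (Finset.mem_sdiff.1 (h he)).2 heT⟩ (hS.mono hLS)
    have hdisj : ∀ u ∈ T, u ∉ S \ T := fun u hu hu' => (Finset.mem_sdiff.1 hu').2 hu
    have hL : Apart T (S \ T) := hS.apart hT hLS hdisj
    have hsub : ∀ s ∈ F, s.leaves ⊆ S \ T := fun s hs u hu =>
      hFL ▸ mem_forestLeaves.2 ⟨s, hs, hu⟩
    have hv : ForestValid (t :: F) := by
      refine ⟨ht, hF, fun p hp q hq => ?_, fun s hs => ?_⟩
      · obtain ⟨s, hs, hqs⟩ := mem_forestPoints.1 hq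
        exact apart_points (s := t) (t := s)
          (fun p hp q hq => hL p (htL ▸ hp) q (hsub s hs hq)) p hp q hqs
      · obtain ⟨q, hq, hq1⟩ := s.exists_leaf_corner_fst
        have hqT := hsub s hs hq
        have h1 := (ht.corner_le (t.leaves_subset (htL ▸ heT : e ∈ t.leaves))).1
        have h2 := he1 q (hLS hqT)
        have h3 := (hL e heT q hqT).1
        omega
    refine ⟨t :: F, hv, ?_, ?_⟩
    · rw [forestLeaves, htL, hFL, Finset.union_sdiff_of_subset hT]
    · intro u hu v hv' huv
      rw [hv.leafBelow_cons]
      rcases Finset.mem_union.1 hu with hu | hu <;> rcases Finset.mem_union.1 hv' with hv' | hv'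
      · exact Or.inl (htc u hu v hv' huv)
      · exact Or.inr (Or.inr ⟨t.leaves_subset hu, forestLeaves_subset F hv'⟩)
      · rw [hFL] at hu
        rw [htL] at hv'
        exact absurd (hdown u (hLS hu) v hv' huv) (Finset.mem_sdiff.1 hu).2
      · exact Or.inr (Or.inl (hFc u hu v hv' huv))

end Existence

/-! ### Forests and heaps -/

theorem Finset.eq_range_of_card {s : Finset ℕ} {n : ℕ} (hs : s.card = n)
    (h : ∀ x ∈ s, ∀ y < x, y ∈ s) : s = Finset.range n := by
  refine Finset.eq_of_subset_of_card_le (fun x hx => ?_) (by simp [hs])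
  have : Finset.range (x + 1) ⊆ s := by
    intro y hy
    rcases (Nat.lt_succ_iff.1 (Finset.mem_range.1 hy)).lt_or_eq with h' | rfl
    · exact h x hx y h'
    · exact hx
  have := Finset.card_le_card this
  rw [Finset.card_range, hs] at this
  exact Finset.mem_range.2 this

/-- Of two points in one column or row, one descends from the other, and a leaf has no proper
descendants. -/
theorem leavesOf_generic (A : Finset (ℕ × ℕ)) : Generic (leavesOf A) := by
  have key : ∀ u ∈ leavesOf A, ∀ v, IsDescendant A u v → u = v := by
    intro u hu v h
    rcases Relation.ReflTransGen.cases_head h with h | ⟨c, hc, -⟩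
    · exact h
    · exact absurd hc ((mem_leavesOf.1 hu).2 c)
  intro u hu v hv hne
  have hu' := (mem_leavesOf.1 hu).1
  have hv' := (mem_leavesOf.1 hv).1
  constructor <;> intro e
  · rcases le_total u.2 v.2 with h | h
    · exact hne (key u hu v (isDescendant_of_column hu' hv' e h))
    · exact hne (key v hv u (isDescendant_of_column hv' hu' e.symm h)).symm
  · rcases le_total u.1 v.1 with h | h
    · exact hne (key u hu v (isDescendant_of_row hu' hv' e h))
    · exact hne (key v hv u (isDescendant_of_row hv' hu' e.symm h)).symm

theorem exists_perm_of_generic {S : Finset (ℕ × ℕ)} {n : ℕ} (hS : Generic S)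
    (h1 : S.image Prod.fst = Finset.range n) (h2 : S.image Prod.snd = Finset.range n) :
    ∃ σ : Equiv.Perm (Fin n), ∀ u, u ∈ S ↔ ∃ i, pathOf σ i = u := by
  have hex : ∀ i : Fin n, ∃ j : Fin n, ((i : ℕ), (j : ℕ)) ∈ S := by
    intro i
    have : (i : ℕ) ∈ S.image Prod.fst := by simp [h1]
    obtain ⟨u, hu, hui⟩ := Finset.mem_image.1 this
    have : u.2 ∈ Finset.range n := h2 ▸ Finset.mem_image_of_mem _ hu
    refine ⟨⟨u.2, Finset.mem_range.1 this⟩, ?_⟩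
    rw [← hui]
    exact hu
  choose f hf using hex
  have hinj : Function.Injective f := by
    intro i j hij
    by_contra hne
    exact (hS _ (hf i) _ (hf j) fun h => hne (Fin.ext (Prod.ext_iff.1 h).1)).2
      (congrArg Fin.val hij)
  refine ⟨Equiv.ofBijective f (Finite.injective_iff_bijective.1 hinj), fun u => ?_⟩
  constructor
  · intro hu
    have : u.1 ∈ Finset.range n := h1 ▸ Finset.mem_image_of_mem _ hu
    refine ⟨⟨u.1, Finset.mem_range.1 this⟩, ?_⟩
    by_contra hne
    exact (hS _ (hf ⟨u.1, Finset.mem_range.1 this⟩) u hu hne).1 rfl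
  · rintro ⟨i, rfl⟩
    exact hf i

theorem Generic.card_image {S : Finset (ℕ × ℕ)} (hS : Generic S) :
    (S.image Prod.fst).card = S.card ∧ (S.image Prod.snd).card = S.card := by
  constructor <;> refine Finset.card_image_of_injOn fun u hu v hv h => ?_
  · by_contra hne
    exact (hS u hu v hv hne).1 h
  · by_contra hne
    exact (hS u hu v hv hne).2 h

theorem pathOf_injective {n : ℕ} (σ : Equiv.Perm (Fin n)) : Function.Injective (pathOf σ) :=
  fun _ _ h => Fin.ext (Prod.ext_iff.1 h).1

/-- Leaves share no row or column, and each occupied column or row contains a leaf. As no column or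
row is skipped, the `n` leaves form a permutation, and the rank of the linear order on them yields
the heap. -/
theorem existsUnique_heap {n : ℕ} (A : CompleteNonAmbiguousForest n) :
    ∃! H : PathHeap n, ForestToHeap A H := by
  obtain ⟨A, hA, hn⟩ := A
  obtain ⟨F, hF, rfl⟩ := hA.exists_forest
  have hL := hF.hasLeaves.leavesOf_eq
  have hg := leavesOf_generic (forestPoints F)
  have h1 : (leavesOf (forestPoints F)).image Prod.fst = Finset.range n := by
    refine Finset.eq_range_of_card (hg.card_image.1.trans hn) fun x hx y hy => ?_
    obtain ⟨u, hu, rfl⟩ := Finset.mem_image.1 hx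
    obtain ⟨q, hq, rfl⟩ := hA.no_empty_column u (mem_leavesOf.1 hu).1 y hy
    obtain ⟨t, ht, hqt⟩ := mem_forestPoints.1 hq
    obtain ⟨p, hp, hpq⟩ := exists_leaf_fst hqt
    rw [hL, ← hpq]
    exact Finset.mem_image_of_mem _ (mem_forestLeaves.2 ⟨t, ht, hp⟩)
  have h2 : (leavesOf (forestPoints F)).image Prod.snd = Finset.range n := by
    refine Finset.eq_range_of_card (hg.card_image.2.trans hn) fun x hx y hy => ?_
    obtain ⟨u, hu, rfl⟩ := Finset.mem_image.1 hx
    obtain ⟨q, hq, rfl⟩ := hA.no_empty_row u (mem_leavesOf.1 hu).1 y hy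
    obtain ⟨t, ht, hqt⟩ := mem_forestPoints.1 hq
    obtain ⟨p, hp, hpq⟩ := exists_leaf_snd hqt
    rw [hL, ← hpq]
    exact Finset.mem_image_of_mem _ (mem_forestLeaves.2 ⟨t, ht, hp⟩)
  obtain ⟨σ, hσ⟩ := exists_perm_of_generic hg h1 h2
  obtain ⟨ρ, hρ⟩ := hF.exists_rank
  obtain ⟨H, rfl, hH⟩ := PathHeap.exists_of_rank σ
    (fun i j => LeafBelow (forestPoints F) (pathOf σ i) (pathOf σ j)) (fun i => ρ (pathOf σ i))
    (fun i j hne _ => hF.leafBelow_or (hL ▸ (hσ _).2 ⟨i, rfl⟩) (hL ▸ (hσ _).2 ⟨j, rfl⟩)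
      ((pathOf_injective σ).ne hne))
    (fun i j h => hρ _ _ h)
  refine ⟨H, ⟨hσ, hH⟩, ?_⟩
  rintro H' ⟨hσ', hH'⟩
  have hperm : H'.perm = H.perm := by
    ext i
    obtain ⟨j, hj⟩ := (hσ _).1 ((hσ' _).2 ⟨i, rfl⟩)
    obtain rfl : j = i := Fin.ext (Prod.ext_iff.1 hj).1
    exact (Prod.ext_iff.1 hj).2.symm
  refine PathHeap.ext_of_crossing hperm fun i j hc => ?_
  have hc' := hc
  rw [hperm] at hc'
  rw [hH' i j hc, hH i j hc', hperm]

/-! ### The order of a heap as a relation between points -/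

namespace PathHeap

variable {n : ℕ} (H : PathHeap n)

/-- The order of the crossing pieces of a heap, as a relation between paths. -/
def CrossingBelow (u v : ℕ × ℕ) : Prop :=
  Crossing u v ∧ ∃ i j, pathOf H.perm i = u ∧ pathOf H.perm j = v ∧ H.Below i j

theorem CrossingBelow.acyclic (u : ℕ × ℕ) : ¬ Relation.TransGen H.CrossingBelow u u := by
  have key : ∀ v, Relation.TransGen H.CrossingBelow u v →
      ∃ i j, pathOf H.perm i = u ∧ pathOf H.perm j = v ∧ H.Below i j := by
    intro v h
    induction h with
    | single h => exact h.2
    | tail _ h ih =>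
      obtain ⟨i, j, hi, hj, hij⟩ := ih
      obtain ⟨j', k, hj', hk, hjk⟩ := h.2
      obtain rfl : j = j' := pathOf_injective _ (hj.trans hj'.symm)
      exact ⟨i, k, hi, hk, hij.trans hjk⟩
  intro h
  obtain ⟨i, j, hi, hj, hij⟩ := key u h
  obtain rfl : i = j := pathOf_injective _ (hi.trans hj.symm)
  exact H.below_irrefl i hij

theorem orientsCrossing {S : Finset (ℕ × ℕ)} (hS : ∀ u, u ∈ S ↔ ∃ i, pathOf H.perm i = u) :
    OrientsCrossing H.CrossingBelow S := by
  intro u hu v hv hne hc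
  obtain ⟨i, rfl⟩ := (hS u).1 hu
  obtain ⟨j, rfl⟩ := (hS v).1 hv
  refine (below_or_below (fun h => hne (congrArg _ h)) hc).imp (fun h => ?_) fun h => ?_
  · exact ⟨hc, i, j, rfl, rfl, h⟩
  · exact ⟨hc.symm, j, i, rfl, rfl, h⟩

end PathHeap

theorem ForestToHeap.forestCompatible {n : ℕ} {A : CompleteNonAmbiguousForest n} {H : PathHeap n}
    (h : ForestToHeap A H) {F : List PointTree} (hF : forestPoints F = A.1) :
    ForestCompatible H.CrossingBelow F := by
  rintro u - v - ⟨hc, i, j, rfl, rfl, hij⟩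
  rw [hF]
  exact (h.2 i j hc).1 hij

/-- Here the relation `R` of the preceding sections is `H.CrossingBelow`. A forest corresponds to
`H` when its leaves are the paths of `H` and its leaf order extends this relation. -/
theorem existsUnique_forest {n : ℕ} (H : PathHeap n) :
    ∃! A : CompleteNonAmbiguousForest n, ForestToHeap A H := by
  classical
  let S : Finset (ℕ × ℕ) := Finset.univ.image (pathOf H.perm)
  have hS : ∀ u, u ∈ S ↔ ∃ i, pathOf H.perm i = u := by simp [S]
  have hg : Generic S := by
    intro u hu v hv hne
    obtain ⟨i, rfl⟩ := (hS u).1 hu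
    obtain ⟨j, rfl⟩ := (hS v).1 hv
    have hij : i ≠ j := fun h => hne (congrArg _ h)
    exact ⟨fun h => hij (Fin.ext h), fun h => hij (H.perm.injective (Fin.ext h))⟩
  obtain ⟨F, hF, hFS, hFc⟩ := exists_forest_of_heap (R := H.CrossingBelow)
    (fun _ _ h => h.1) (PathHeap.CrossingBelow.acyclic H) S hg
  have hL : leavesOf (forestPoints F) = S := hF.hasLeaves.leavesOf_eq.trans hFS
  have hmem : ∀ i, pathOf H.perm i ∈ forestLeaves F := fun i => hFS ▸ (hS _).2 ⟨i, rfl⟩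
  have hA : IsCompleteNonAmbiguousForest (forestPoints F) :=
    { not_both := hF.notBoth
      no_empty_column := by
        intro p hp x hx
        obtain ⟨t, ht, hpt⟩ := mem_forestPoints.1 hp
        obtain ⟨q, hq, hqp⟩ := exists_leaf_fst hpt
        obtain ⟨i, rfl⟩ := (hS q).1 (hFS ▸ mem_forestLeaves.2 ⟨t, ht, hq⟩)
        rw [← hqp] at hx
        have hi : x < n := lt_trans hx i.2
        exact ⟨_, forestLeaves_subset F (hmem ⟨x, hi⟩), rfl⟩
      no_empty_row := by
        intro p hp y hy
        obtain ⟨t, ht, hpt⟩ := mem_forestPoints.1 hp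
        obtain ⟨q, hq, hqp⟩ := exists_leaf_snd hpt
        obtain ⟨i, rfl⟩ := (hS q).1 (hFS ▸ mem_forestLeaves.2 ⟨t, ht, hq⟩)
        rw [← hqp] at hy
        have hi : y < n := lt_trans hy (H.perm i).2
        exact ⟨_, forestLeaves_subset F (hmem (H.perm.symm ⟨y, hi⟩)), by simp [pathOf]⟩
      complete := hF.hasLeaves.complete }
  have hn : (leavesOf (forestPoints F)).card = n := by
    rw [hL, Finset.card_image_of_injective _ (pathOf_injective _), Finset.card_univ,
      Fintype.card_fin]
  obtain ⟨ρ, hρ⟩ := hF.exists_rank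
  refine ⟨⟨forestPoints F, hA, hn⟩, ⟨fun u => ?_, fun i j hc => ⟨fun hb => ?_, fun hb => ?_⟩⟩, ?_⟩
  · rw [hL]
    exact hS u
  · exact hFc _ (hmem i) _ (hmem j) ⟨hc, i, j, rfl, rfl, hb⟩
  -- Compatibility is only one implication. The converse holds because crossing pieces are
  -- comparable in the heap, and the rank excludes both directions in the leaf order.
  · have hne : i ≠ j := by
      rintro rfl
      exact lt_irrefl _ (hρ _ _ hb)
    refine (PathHeap.below_or_below hne hc).resolve_right fun hb' => ?_
    have := hFc _ (hmem j) _ (hmem i) ⟨hc.symm, j, i, rfl, rfl, hb'⟩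
    exact lt_asymm (hρ _ _ hb) (hρ _ _ this)
  · rintro A' hA'
    obtain ⟨F', hF', hFA⟩ := A'.2.1.exists_forest
    refine Subtype.ext ?_
    have hL' : forestLeaves F' = forestLeaves F := by
      rw [hFS, ← hF'.hasLeaves.leavesOf_eq, hFA]
      ext u
      exact (hA'.1 u).trans (hS u).symm
    have : F' = F := hF'.eq_of_leaves_eq hF hL'
      (H.orientsCrossing (by rw [hL', hFS]; exact hS)) (hA'.forestCompatible hFA) hFc
    rw [← hFA, this]

theorem exists_equiv_of_existsUnique {α β : Type*} {r : α → β → Prop} (h : ∀ a, ∃! b, r a b)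
    (h' : ∀ b, ∃! a, r a b) : ∃ e : α ≃ β, ∀ a, r a (e a) := by
  choose f hf hf' using h
  choose g hg hg' using h'
  exact ⟨⟨f, g, fun a => (hg' _ _ (hf a)).symm, fun b => (hf' _ _ (hg b)).symm⟩, hf⟩

theorem mainTheorem4 (n : ℕ) :
    (∃ f : CompleteNonAmbiguousForest n ≃ NoCommonRisePair n,
      ∃ (s : CompleteNonAmbiguousForest n ≃ PathHeap n) (t : NoCommonRisePair n ≃ PathHeap n),
        (∀ A, ForestToHeap A (s A)) ∧ (∀ p, PairToHeap p (t p)) ∧ f = s.trans t.symm) ∧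
    Finite (CompleteNonAmbiguousForest n) ∧
    Nat.card (CompleteNonAmbiguousForest n) = Nat.card (NoCommonRisePair n) := by
  obtain ⟨s, hs⟩ := exists_equiv_of_existsUnique (existsUnique_heap (n := n)) existsUnique_forest
  obtain ⟨t, ht⟩ := exists_equiv_of_existsUnique (existsUnique_pairToHeap (n := n))
    existsUnique_pair
  -- Pairs of permutations are visibly finite in number; finiteness of the set of forests is carried
  -- over by the bijection.
  have : Finite (NoCommonRisePair n) := Subtype.finite
  exact ⟨⟨s.trans t.symm, s, t, hs, ht, rfl⟩, Finite.of_equiv _ (s.trans t.symm).symm,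
    Nat.card_congr (s.trans t.symm)⟩
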